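/- Let $\Gamma$ be a connected amply regular graph with diameter $4$ and parameters $(v,k,0,\mu)$, where $k\ge 5$ is odd and $\mu=\frac{k-1}{2}$; that is, $\Gamma$ is a finite connected $k$-regular graph on $v$ vertices of diameter $4$, adjacent vertices have no common neighbours, and any two vertices at distance $2$ have exactly $\frac{k-1}{2}$ common neighbours. Let $\Lambda$ be the point–block incidence graph of a square $2$-$(7,4,2)$ design; up to isomorphism, $\Lambda$ is the unique bipartite $(0,2)$-graph with $14$ vertices and valency $4$ (a $(0,2)$-graph is a connected graph in which any two distinct vertices have $0$ or $2$ common neighbours). Then $\Gamma$ is bipartite, and exactly one of the following holds: (1) $\Gamma$ is isomorphic to the Cartesian product $\mathrm{K}_2\,\square\,\Lambda$; (2) for every vertex $x$ of $\Gamma$ there is a partition of the vertex set into parts $B_0,\dots,B_5$ of sizes $1,\,k,\,2k,\,k,\,1,\,2$, one of whose parts is $\{x\}$, such that for all $i,j$ every vertex of $B_i$ has exactly $q_{ij}$ neighbours in $B_j$, where $$Q=(q_{ij})=\begin{pmatrix}0&k&0&0&0&0\\ 1&0&k-1&0&0&0\\ 0&\frac{k-1}{2}&0&\frac{k-1}{2}&0&1\\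 0&0&k-1&0&1&0\\ 0&0&0&k&0&0\\ 0&0&k&0&0&0\end{pmatrix}$$ (that is, $\Gamma$ is a bipartite $Q$-regular graph). In case (2), every vertex of $\Gamma$ has exactly one vertex at distance $4$ from it, and $v=4k+4$. -/

import Mathlib

namespace AmplyRegular

/-- A graph is amply regular with parameters `(v, k, l, m)` if it has `v` vertices, is `k`-regular,
adjacent vertices have exactly `l` common neighbours, and vertices at distance two have exactly `m`
common neighbours. -/
structure IsAmplyRegularWith {V : Type*} [Fintype V] [DecidableEq V] (G : SimpleGraph V)
    [DecidableRel G.Adj] (v k l m : ℕ) : Prop where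
  card : Fintype.card V = v
  regular : G.IsRegularOfDegree k
  of_adj : ∀ x y : V, G.Adj x y → Fintype.card (G.commonNeighbors x y) = l
  of_dist_two : ∀ x y : V, G.dist x y = 2 → Fintype.card (G.commonNeighbors x y) = m

/-- A `(0,2)`-graph: a connected graph in which any two distinct vertices have either `0` or `2`
common neighbours. -/
structure IsZeroTwoGraph {V : Type*} [Fintype V] [DecidableEq V] (G : SimpleGraph V)
    [DecidableRel G.Adj] : Prop where
  connected : G.Connected
  zero_or_two : ∀ x y : V, x ≠ y →
    Fintype.card (G.commonNeighbors x y) = 0 ∨ Fintype.card (G.commonNeighbors x y) = 2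

/-- The point–block incidence graph of an incidence structure `(P, B, I)`. -/
def incidenceGraph {P B : Type*} (I : P → B → Prop) : SimpleGraph (P ⊕ B) where
  Adj
    | Sum.inl p, Sum.inr b => I p b
    | Sum.inr b, Sum.inl p => I p b
    | _, _ => False
  symm := ⟨by rintro (_ | _) (_ | _) h <;> exact h⟩
  loopless := ⟨by rintro (_ | _) h <;> exact h⟩

instance {P B : Type*} (I : P → B → Prop) [h : ∀ p b, Decidable (I p b)] :
    DecidableRel (incidenceGraph I).Adj
  | Sum.inl p, Sum.inr b => h p b
  | Sum.inr b, Sum.inl p => h p b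
  | Sum.inl _, Sum.inl _ => isFalse id
  | Sum.inr _, Sum.inr _ => isFalse id

/-- The incidence structure `(P, B, I)` is a square `2`-`(v, k, l)` design: there are `v` points and
`v` blocks, every block has `k` points, and any two distinct points lie in exactly `l` blocks. -/
structure IsSquareTwoDesign {P B : Type*} [Fintype P] [Fintype B] (I : P → B → Prop)
    [∀ p b, Decidable (I p b)] (v k l : ℕ) : Prop where
  card_points : Fintype.card P = v
  card_blocks : Fintype.card B = v
  block_size : ∀ b : B, Fintype.card {p : P // I p b} = k
  pair_count : ∀ p q : P, p ≠ q → Fintype.card {b : B // I p b ∧ I q b} = l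

/-- The blocks are the translates in `ℤ/7` of the set `{0, 3, 5, 6}` of non-residues together with
`0` (the complements of the lines of the Fano plane). -/
def lambdaIncidence (p b : Fin 7) : Prop :=
  p - b = 0 ∨ p - b = 3 ∨ p - b = 5 ∨ p - b = 6

instance (p b : Fin 7) : Decidable (lambdaIncidence p b) := by
  unfold lambdaIncidence; infer_instance

theorem lambdaIncidence_isSquareTwoDesign : IsSquareTwoDesign lambdaIncidence 7 4 2 where
  card_points := by decide
  card_blocks := by decide
  block_size := by decide
  pair_count := by decide

/-- The graph `Λ`: the point–block incidence graph of a square `2`-`(7, 4, 2)` design. -/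
def lambdaGraph : SimpleGraph (Fin 7 ⊕ Fin 7) := incidenceGraph lambdaIncidence

/-- `G` is a bipartite `(0,2)`-graph with `14` vertices and valency `4`. -/
structure IsBipartiteZeroTwoGraph144 {V : Type*} [Fintype V] [DecidableEq V] (G : SimpleGraph V)
    [DecidableRel G.Adj] : Prop where
  bipartite : G.IsBipartite
  zeroTwo : IsZeroTwoGraph G
  card : Fintype.card V = 14
  regular : G.IsRegularOfDegree 4

/-- The map `B : V → Fin n`, regarded as the partition of the vertex set into the parts
`B ⁻¹' {i}` (all of them nonempty), is an equitable partition of `G` whose distribution diagram has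
the numbers `p i` (the size of the `i`-th part) and `Q i j` (the number of neighbours in the `j`-th
part of each vertex of the `i`-th part). -/
structure IsEquitableWithDiagram {V : Type*} [Fintype V] (G : SimpleGraph V) [DecidableRel G.Adj]
    {n : ℕ} (B : V → Fin n) (p : Fin n → ℕ) (Q : Matrix (Fin n) (Fin n) ℕ) : Prop where
  nonempty : Function.Surjective B
  size : ∀ i, Fintype.card {x : V // B x = i} = p i
  neighbors : ∀ (x : V) (j : Fin n), Fintype.card {y : V // G.Adj x y ∧ B y = j} = Q (B x) j

/-- `G` is `Q`-regular with distribution diagram `(p, Q)`: for each vertex `x` there is an equitable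
partition with that diagram such that `{x}` is a part. -/
def IsQRegularWithDiagram {V : Type*} [Fintype V] (G : SimpleGraph V) [DecidableRel G.Adj]
    {n : ℕ} (p : Fin n → ℕ) (Q : Matrix (Fin n) (Fin n) ℕ) : Prop :=
  ∀ x : V, ∃ B : V → Fin n, IsEquitableWithDiagram G B p Q ∧ ∃ i, ∀ y, B y = i ↔ y = x

/-- The part sizes of the distribution diagram with six parts: a vertex `x`; its neighbours;
the vertices at distance `2`; the neighbours of the antipode of `x`; the antipode of `x`;
the two remaining vertices. -/
def diagramSizes (k : ℕ) : Fin 6 → ℕ := ![1, k, 2 * k, k, 1, 2]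

/-- The quotient matrix of the distribution diagram with six parts (for odd `k`). -/
def diagramMatrix (k : ℕ) : Matrix (Fin 6) (Fin 6) ℕ :=
  !![0, k, 0, 0, 0, 0;
     1, 0, k - 1, 0, 0, 0;
     0, (k - 1) / 2, 0, (k - 1) / 2, 0, 1;
     0, 0, k - 1, 0, 1, 0;
     0, 0, 0, k, 0, 0;
     0, 0, k, 0, 0, 0]

end AmplyRegular

/-!
Write `k = 2 * m + 1`, so that vertices at distance two have `m` common neighbours, and let `S x` be
the set of vertices at distance two from `x`; it has `4 * m + 2` elements. The proof compares `S x`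
and `S y` for two vertices `x`, `y` at distance four.

*Equal second spheres.* If `S x = S y`, then the neighbours of `S x` together with those of `x` and
`y` are joined only to `X = S x ∪ {x, y}`, so `X` is one half of a bipartition, and by regularity
`G` has `2 * (4 * m + 4) = 4 * k + 4` vertices (`IsHalfRegular.isBipartite_of_secondSphere_eq`). In a
bipartite graph of this size every vertex has exactly one vertex on its side outside its second
sphere, which gives both the antipodes and the equitable partition with matrix `Q`
(`IsHalfRegular.exists_antipode`, `IsHalfRegular.isQRegular`).

*The case `m ≥ 3`.* For a midpoint `z` of `x` and `y`, the sets `N(w) ∩ N(z)` with `w` in `S z` are the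
blocks of a `2`-`(2 * m + 1, m, m - 1)` design, and those of `x` and `y` are disjoint. The first two
moments of the sizes of the intersections of the blocks with that of `x` leave no room for another
block disjoint from it (`IsHalfRegular.inter_nonempty`), which forces `S x = S y`
(`IsHalfRegular.secondSphere_subset`).

*The case `m = 2`.* Now two vertices at distance two have exactly two common neighbours, so the ten
vertices of `S x` correspond to the pairs `ij` of the five neighbours of `x` (`IsFrame`), and the
other vertices are described by the cycles formed by the pairs adjacent to them. The pairs that are
not in `S y` form a matching (`IsFrame.exists_mid`, `IsFrame.missing_unique`), hence there are at
most two. If there is none, then `S x = S y`; one is impossible (`IsFrame.false_of_one_missing`);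
and two determine all adjacencies, which are those of `K₂ □ Λ`
(`IsFrame.nonempty_iso_of_two_missing`).

The alternatives exclude each other, since `K₂ □ Λ` has `28` vertices and `28 = 4 * k + 4` would make
`k` even. The uniqueness of `Λ` comes from the same labels, around a vertex of valency four
(`isBipartiteZeroTwoGraph144_iff`).
-/

namespace AmplyRegular

open Finset

/-! ### Triangle-free graphs of valency `2 * m + 1` with `m` common neighbours at distance two -/

variable {V : Type*} [Fintype V] [DecidableEq V] (G : SimpleGraph V) [DecidableRel G.Adj]

/-- The local form of the hypotheses: `G` is a triangle-free regular graph of valency `2 * m + 1`,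
and two distinct vertices with a common neighbour have exactly `m ≥ 2` common neighbours. -/
structure IsHalfRegular (m : ℕ) : Prop where
  two_le : 2 ≤ m
  card_nbr : ∀ x, #(G.neighborFinset x) = 2 * m + 1
  triangle : ∀ {x y z}, G.Adj x y → G.Adj y z → ¬ G.Adj x z
  card_common : ∀ {x y z}, x ≠ y → G.Adj x z → G.Adj y z →
    #(G.neighborFinset x ∩ G.neighborFinset y) = m

/-- The vertices other than `x` that have a common neighbour with `x`; in a triangle-free graph
these are the vertices at distance two from `x`. -/
def secondSphere (x : V) : Finset V := {w | w ≠ x ∧ ∃ a, G.Adj x a ∧ G.Adj w a}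

/-- There is no walk of length at most three between `x` and `y` (if neither vertex is
isolated). -/
def IsFar (x y : V) : Prop := ∀ ⦃a b⦄, G.Adj x a → G.Adj y b → a ≠ b ∧ ¬ G.Adj a b

variable {G}

lemma mem_secondSphere {x w : V} :
    w ∈ secondSphere G x ↔ w ≠ x ∧ ∃ a, G.Adj x a ∧ G.Adj w a := by
  simp [secondSphere]

lemma mem_secondSphere_comm {x w : V} : w ∈ secondSphere G x ↔ x ∈ secondSphere G w := by
  rw [mem_secondSphere, mem_secondSphere]
  exact ⟨fun ⟨h, a, h1, h2⟩ => ⟨h.symm, a, h2, h1⟩, fun ⟨h, a, h1, h2⟩ => ⟨h.symm, a, h2, h1⟩⟩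

lemma IsFar.symm {x y : V} (h : IsFar G x y) : IsFar G y x :=
  fun _ _ ha hb => ⟨(h hb ha).1.symm, fun h' => (h hb ha).2 h'.symm⟩

namespace IsHalfRegular

variable {m : ℕ} (hG : IsHalfRegular G m)

include hG

lemma card_inter {x w : V} (hw : w ∈ secondSphere G x) :
    #(G.neighborFinset w ∩ G.neighborFinset x) = m := by
  obtain ⟨h, a, h1, h2⟩ := mem_secondSphere.1 hw
  exact hG.card_common h h2 h1

/-- Two distinct vertices with a common neighbour have a second one. -/
lemma exists_other {x y z : V} (hxy : x ≠ y) (hx : G.Adj x z) (hy : G.Adj y z) :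
    ∃ w, w ≠ z ∧ G.Adj x w ∧ G.Adj y w := by
  have h := hG.card_common hxy hx hy
  have h2 : 1 < #(G.neighborFinset x ∩ G.neighborFinset y) := by have := hG.two_le; omega
  obtain ⟨w, hw, hne⟩ := Finset.exists_mem_ne h2 z
  simp only [mem_inter, SimpleGraph.mem_neighborFinset] at hw
  exact ⟨w, hne, hw.1, hw.2⟩

lemma exists_adj (x : V) : ∃ a, G.Adj x a := by
  have : 0 < #(G.neighborFinset x) := by rw [hG.card_nbr]; omega
  obtain ⟨a, ha⟩ := Finset.card_pos.1 this
  exact ⟨a, by simpa using ha⟩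

lemma not_adj_of_mem {x w : V} (hw : w ∈ secondSphere G x) : ¬ G.Adj x w := by
  obtain ⟨h, a, h1, h2⟩ := mem_secondSphere.1 hw
  exact hG.triangle h1 h2.symm

lemma mem_of_adj {x a w : V} (hxa : G.Adj x a) (haw : G.Adj a w) (h : w ≠ x) :
    w ∈ secondSphere G x := mem_secondSphere.2 ⟨h, a, hxa, haw.symm⟩

lemma neighbor_inter_secondSphere {x a : V} (hxa : G.Adj x a) :
    G.neighborFinset a ∩ secondSphere G x = (G.neighborFinset a).erase x := by
  ext w
  simp only [mem_inter, SimpleGraph.mem_neighborFinset, mem_erase]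
  constructor
  · rintro ⟨h1, h2⟩
    exact ⟨(mem_secondSphere.1 h2).1, h1⟩
  · rintro ⟨h1, h2⟩
    exact ⟨h2, hG.mem_of_adj hxa h2 h1⟩

lemma card_neighbor_inter_secondSphere {x a : V} (hxa : G.Adj x a) :
    #(G.neighborFinset a ∩ secondSphere G x) = 2 * m := by
  rw [hG.neighbor_inter_secondSphere hxa, card_erase_of_mem (by simpa using hxa.symm),
    hG.card_nbr]
  omega

lemma card_secondSphere (x : V) : #(secondSphere G x) = 4 * m + 2 := by
  have h := Finset.card_mul_eq_card_mul (s := secondSphere G x) (t := G.neighborFinset x)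
    (fun a b => G.Adj a b) (m := m) (n := 2 * m)
    (fun w hw => by
      rw [← hG.card_inter hw]
      congr 1; ext a; simp [mem_bipartiteAbove, and_comm])
    (fun a ha => by
      rw [← hG.card_neighbor_inter_secondSphere (x := x) (a := a) (by simpa using ha)]
      congr 1; ext w; simp [mem_bipartiteBelow, and_comm, G.adj_comm])
  rw [hG.card_nbr] at h
  have := hG.two_le
  nlinarith

/-- For a vertex `z` at distance two from both vertices of a far pair `x`, `y`, all neighbours
of `z` but one are adjacent to `x` or to `y`, since `2 * m + 1 = m + m + 1`. The exceptional one is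
at distance at least three from `x` and `y`. -/
lemma exists_star {x y z : V} (hxy : IsFar G x y) (hx : z ∈ secondSphere G x)
    (hy : z ∈ secondSphere G y) :
    ∃ e, G.Adj z e ∧ ¬ G.Adj x e ∧ ¬ G.Adj y e ∧ e ∉ secondSphere G x ∧ e ∉ secondSphere G y ∧
      (∀ w, G.Adj z w → G.Adj x w ∨ G.Adj y w ∨ w = e) ∧
      ∀ w, G.Adj e w → w ∈ secondSphere G x ∨ w ∈ secondSphere G y := by
  have hd : Disjoint (G.neighborFinset z ∩ G.neighborFinset x)
      (G.neighborFinset z ∩ G.neighborFinset y) := by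
    rw [Finset.disjoint_left]
    intro a h1 h2
    simp only [mem_inter, SimpleGraph.mem_neighborFinset] at h1 h2
    exact (hxy h1.2 h2.2).1 rfl
  have hsub : (G.neighborFinset z ∩ G.neighborFinset x) ∪
      (G.neighborFinset z ∩ G.neighborFinset y) ⊆ G.neighborFinset z :=
    union_subset inter_subset_left inter_subset_left
  have hc := card_sdiff_add_card_eq_card hsub
  rw [card_union_of_disjoint hd, hG.card_inter hx, hG.card_inter hy, hG.card_nbr] at hc
  have hc1 : #(G.neighborFinset z \ ((G.neighborFinset z ∩ G.neighborFinset x) ∪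
      (G.neighborFinset z ∩ G.neighborFinset y))) = 1 := by omega
  obtain ⟨e, he⟩ := card_eq_one.1 hc1
  have hmem : ∀ w, (G.Adj z w ∧ ¬ G.Adj x w ∧ ¬ G.Adj y w) ↔ w = e := by
    intro w
    rw [← mem_singleton, ← he]
    simp only [mem_sdiff, mem_union, mem_inter, SimpleGraph.mem_neighborFinset]
    tauto
  obtain ⟨hze, hxe, hye⟩ := (hmem e).2 rfl
  have hall : ∀ w, G.Adj z w → G.Adj x w ∨ G.Adj y w ∨ w = e := by
    intro w hw
    by_contra! h
    exact h.2.2 ((hmem w).1 ⟨hw, h.1, h.2.1⟩)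
  have key : ∀ x' y', IsFar G x' y' → z ∈ secondSphere G x' →
      (∀ w, G.Adj z w → G.Adj x' w ∨ G.Adj y' w ∨ w = e) → e ∉ secondSphere G x' := by
    intro x' y' hf hz hall' he'
    obtain ⟨hne, a, h1, h2⟩ := mem_secondSphere.1 he'
    -- `a` and `z` have the common neighbour `e`, hence a second one
    have haz : a ≠ z := by rintro rfl; exact hG.not_adj_of_mem hz h1
    obtain ⟨w, hwe, haw, hzw⟩ := hG.exists_other haz h2.symm hze
    rcases hall' w hzw with h | h | h
    · exact hG.triangle h1 haw h
    · exact (hf h1 h).2 haw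
    · exact hwe h
  refine ⟨e, hze, hxe, hye, key x y hxy hx hall, key y x hxy.symm hy (fun w hw => ?_), hall, ?_⟩
  · have := hall w hw; tauto
  · intro w hw
    by_cases hzw : w = z
    · subst hzw; exact Or.inl hx
    obtain ⟨a, hae, hwa, hza⟩ := hG.exists_other hzw hw.symm hze
    rcases hall a hza with h | h | h
    · left; refine hG.mem_of_adj h hwa.symm ?_
      rintro rfl; exact hxe hw.symm
    · right; refine hG.mem_of_adj h hwa.symm ?_
      rintro rfl; exact hye hw.symm
    · exact absurd h hae

end IsHalfRegular

/-! ### Valency at least seven, and graphs whose second spheres coincide -/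

namespace IsHalfRegular

variable {m : ℕ} (hG : IsHalfRegular G m)

include hG

/-- The blocks `N(D) ∩ N(z)`, for `D` in the second sphere of `z`, form a
`2`-`(2 * m + 1, m, m - 1)` design on `N(z)`. The first two moments of the sizes of their
intersections with a subset `B` of `N(z)` of size `m`. -/
lemma sum_card_inter {z : V} {B : Finset V} (hB : B ⊆ G.neighborFinset z) (hc : #B = m) :
    ∑ D ∈ secondSphere G z, #(G.neighborFinset D ∩ B) = m * (2 * m) ∧
    ∑ D ∈ secondSphere G z, #(G.neighborFinset D ∩ B) ^ 2 =
      m * (2 * m) + m * (m - 1) * (m - 1) := by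
  have hadj : ∀ b ∈ B, G.Adj z b := fun b hb => by simpa using hB hb
  have h1 : ∀ D, #(G.neighborFinset D ∩ B) = ∑ b ∈ B, if G.Adj D b then 1 else 0 := by
    intro D
    rw [Finset.sum_boole, Nat.cast_id]
    congr 1; ext b; simp [and_comm]
  have h2 : ∀ b ∈ B, ∑ D ∈ secondSphere G z, (if G.Adj D b then 1 else 0) = 2 * m := by
    intro b hb
    rw [Finset.sum_boole, Nat.cast_id, ← hG.card_neighbor_inter_secondSphere (hadj b hb)]
    congr 1; ext D; simp [and_comm, G.adj_comm]
  have h3 : ∀ b ∈ B, ∀ b' ∈ B, b' ≠ b →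
      ∑ D ∈ secondSphere G z, (if G.Adj D b then 1 else 0) * (if G.Adj D b' then 1 else 0)
        = m - 1 := by
    intro b hb b' hb' hne
    have := hG.card_common hne (hadj b' hb').symm (hadj b hb).symm
    rw [← this, ← card_erase_of_mem (a := z)
      (by simp [(hadj b hb).symm, (hadj b' hb').symm])]
    have hand : ∀ D, (if G.Adj D b then 1 else 0) * (if G.Adj D b' then 1 else 0)
        = if G.Adj D b ∧ G.Adj D b' then 1 else 0 := by
      intro D; split_ifs <;> simp_all
    simp_rw [hand]
    rw [Finset.sum_boole, Nat.cast_id]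
    congr 1; ext D
    simp only [mem_filter, mem_erase, mem_inter, SimpleGraph.mem_neighborFinset]
    constructor
    · rintro ⟨h, h1, h2⟩; exact ⟨(mem_secondSphere.1 h).1, h2.symm, h1.symm⟩
    · rintro ⟨h, h1, h2⟩; exact ⟨hG.mem_of_adj (hadj b hb) h2 h, h2.symm, h1.symm⟩
  constructor
  · simp_rw [h1]
    rw [Finset.sum_comm, Finset.sum_congr rfl h2, sum_const, hc, smul_eq_mul]
  · simp_rw [h1, sq, Finset.sum_mul_sum]
    rw [Finset.sum_comm]
    have h4 : ∀ b ∈ B, ∑ D ∈ secondSphere G z, ∑ b' ∈ B,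
        (if G.Adj D b then 1 else 0) * (if G.Adj D b' then 1 else 0)
          = 2 * m + (m - 1) * (m - 1) := by
      intro b hb
      rw [Finset.sum_comm, ← Finset.add_sum_erase _ _ hb]
      congr 1
      · rw [← h2 b hb]
        refine sum_congr rfl fun D _ => ?_
        split_ifs <;> rfl
      · rw [Finset.sum_congr rfl (fun b' hb' => h3 b hb b' (mem_of_mem_erase hb')
          (ne_of_mem_erase hb')), sum_const, card_erase_of_mem hb, hc, smul_eq_mul]
    rw [Finset.sum_congr rfl h4, sum_const, hc, smul_eq_mul]
    ring

/-- If `m ≥ 3` and two vertices `x`, `y` of the second sphere of `z` have disjoint blocks in `N(z)`,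
then every other block meets the block of `x`: the moments force the intersection
sizes to be the two integers nearest to their mean. -/
lemma inter_nonempty {x y z D : V} (hm : 3 ≤ m) (hx : x ∈ secondSphere G z)
    (hy : y ∈ secondSphere G z) (hxy : ∀ a, G.Adj z a → G.Adj x a → ¬ G.Adj y a)
    (hD : D ∈ secondSphere G z) (hDx : D ≠ x) (hDy : D ≠ y) :
    ∃ a, G.Adj z a ∧ G.Adj x a ∧ G.Adj D a := by
  by_contra! hcon
  set B := G.neighborFinset x ∩ G.neighborFinset z with hBdef
  have hBc : #B = m := hG.card_inter hx
  obtain ⟨s1, s2⟩ := hG.sum_card_inter (B := B) inter_subset_right hBc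
  have tx : #(G.neighborFinset x ∩ B) = m := by
    rw [hBdef, ← inter_assoc, inter_self]; exact hBc
  have t0 : ∀ w, (∀ a, G.Adj z a → G.Adj x a → ¬ G.Adj w a) → #(G.neighborFinset w ∩ B) = 0 := by
    intro w hw
    rw [card_eq_zero, eq_empty_iff_forall_notMem]
    intro a ha
    simp only [hBdef, mem_inter, SimpleGraph.mem_neighborFinset] at ha
    exact hw a ha.2.2 ha.2.1 ha.1
  have ty := t0 y hxy
  have tD := t0 D hcon
  have hne : y ≠ x := by
    rintro rfl
    rw [tx] at ty; omega
  set t : V → ℤ := fun w => (#(G.neighborFinset w ∩ B) : ℤ) with ht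
  set T := ((secondSphere G z).erase x).erase y with hT
  have hyx : y ∈ (secondSphere G z).erase x := mem_erase.2 ⟨hne, hy⟩
  have split : ∀ f : V → ℤ, ∑ w ∈ secondSphere G z, f w = f x + (f y + ∑ w ∈ T, f w) := by
    intro f
    rw [← add_sum_erase _ _ hx, ← add_sum_erase _ _ hyx]
  have hcT : (#T : ℤ) = 4 * m := by
    have h1 := card_erase_of_mem hyx
    have h2 := card_erase_of_mem hx
    rw [hG.card_secondSphere] at h2
    rw [hT, h1, h2]; push_cast [Nat.add_sub_cancel]; ring
  have e1 : ∑ w ∈ T, t w = m * (2 * m) - m := by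
    have := split t
    have h : ∑ w ∈ secondSphere G z, t w = m * (2 * m) := by
      have := congrArg (Nat.cast (R := ℤ)) s1
      push_cast at this
      exact this
    simp only [ht] at this h ⊢
    rw [h, tx, ty] at this
    push_cast at this; linarith
  have e2 : ∑ w ∈ T, t w ^ 2 = m * (2 * m) + m * (m - 1) * (m - 1) - m ^ 2 := by
    have := split (fun w => t w ^ 2)
    have h : ∑ w ∈ secondSphere G z, t w ^ 2 = m * (2 * m) + m * (m - 1) * (m - 1) := by
      have := congrArg (Nat.cast (R := ℤ)) s2
      push_cast [Nat.cast_sub (show 1 ≤ m by omega)] at this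
      exact this
    simp only [ht] at this h ⊢
    rw [h, tx, ty] at this
    push_cast at this; linarith
  have hDT : D ∈ T := mem_erase.2 ⟨hDy, mem_erase.2 ⟨hDx, hD⟩⟩
  have tD' : t D = 0 := by simp [ht, tD]
  -- the mean of `t` on `T` is `(2 * m - 1) / 4`; the product of the differences of `t w` and the two
  -- consecutive integers around the mean is nonnegative, and the moments make the sum of these
  -- products zero
  obtain ⟨c, hc⟩ : ∃ c : ℤ, ((m : ℤ) = 2 * c ∨ (m : ℤ) = 2 * c + 1) := ⟨m / 2, by omega⟩
  rcases hc with hc | hc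
  · have hs : ∑ w ∈ T, (t w - c) * (t w - c + 1) = 0 := by
      have : ∀ w, (t w - c) * (t w - c + 1) = t w ^ 2 + (1 - 2 * c) * t w + c * (c - 1) := by
        intro w; ring
      simp_rw [this]
      rw [sum_add_distrib, sum_add_distrib, ← mul_sum, e1, e2, sum_const, nsmul_eq_mul, hcT, hc]
      ring
    have := (sum_eq_zero_iff_of_nonneg (fun w _ => ?_)).1 hs D hDT
    · rw [tD'] at this
      have : c * (c - 1) = 0 := by linarith
      rcases mul_eq_zero.1 this with h | h <;> omega
    · rcases le_or_gt c (t w) with h | h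
      · exact mul_nonneg (by omega) (by omega)
      · exact mul_nonneg_of_nonpos_of_nonpos (by omega) (by omega)
  · have hs : ∑ w ∈ T, (t w - c) * (t w - c - 1) = 0 := by
      have : ∀ w, (t w - c) * (t w - c - 1) = t w ^ 2 + (- 1 - 2 * c) * t w + c * (c + 1) := by
        intro w; ring
      simp_rw [this]
      rw [sum_add_distrib, sum_add_distrib, ← mul_sum, e1, e2, sum_const, nsmul_eq_mul, hcT, hc]
      ring
    have := (sum_eq_zero_iff_of_nonneg (fun w _ => ?_)).1 hs D hDT
    · rw [tD'] at this
      have : c * (c + 1) = 0 := by linarith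
      rcases mul_eq_zero.1 this with h | h <;> omega
    · rcases le_or_gt (t w) c with h | h
      · exact mul_nonneg_of_nonpos_of_nonpos (by omega) (by omega)
      · exact mul_nonneg (by omega) (by omega)

/-- For `m ≥ 3`, the second sphere of one vertex of a far pair with a midpoint is contained in that
of the other; by symmetry, the two coincide. -/
lemma secondSphere_subset {x y z : V} (hm : 3 ≤ m) (hxy : IsFar G x y)
    (hx : z ∈ secondSphere G x) (hy : z ∈ secondSphere G y) :
    secondSphere G x ⊆ secondSphere G y := by
  -- a vertex at distance two from a midpoint `w` is a midpoint or one of `x`, `y`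
  have key : ∀ w, w ∈ secondSphere G x → w ∈ secondSphere G y → ∀ D ∈ secondSphere G w,
      D ≠ x → D ≠ y → D ∈ secondSphere G x ∩ secondSphere G y := by
    intro w hwx hwy D hD hDx hDy
    rw [mem_inter]
    constructor
    · obtain ⟨a, _, h2, h3⟩ := hG.inter_nonempty hm (mem_secondSphere_comm.1 hwx)
        (mem_secondSphere_comm.1 hwy) (fun a _ h1 h2 => (hxy h1 h2).1 rfl) hD hDx hDy
      exact hG.mem_of_adj h2 h3.symm hDx
    · obtain ⟨a, _, h2, h3⟩ := hG.inter_nonempty hm (mem_secondSphere_comm.1 hwy)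
        (mem_secondSphere_comm.1 hwx) (fun a _ h1 h2 => (hxy h2 h1).1 rfl) hD hDy hDx
      exact hG.mem_of_adj h2 h3.symm hDy
  -- so the second sphere of `x` contains at most one further vertex `u`, which has no common
  -- neighbour with any midpoint
  intro u hu
  by_contra huy
  have huM : u ∉ secondSphere G x ∩ secondSphere G y := fun h => huy (mem_inter.1 h).2
  have hMc : ∀ v ∈ secondSphere G x, v ≠ u → v ∈ secondSphere G y := by
    set F := insert z (((secondSphere G z).erase x).erase y) with hF
    have hxne : x ≠ y := by
      rintro rfl
      obtain ⟨a, ha⟩ := hG.exists_adj x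
      exact (hxy ha ha).1 rfl
    have hFc : #F = 4 * m + 1 := by
      rw [hF, card_insert_of_notMem, card_erase_of_mem, card_erase_of_mem, hG.card_secondSphere]
      · omega
      · exact mem_secondSphere_comm.1 hx
      · exact mem_erase.2 ⟨hxne.symm, mem_secondSphere_comm.1 hy⟩
      · simp [mem_secondSphere]
    have hFM : F ⊆ secondSphere G x ∩ secondSphere G y := by
      intro w hw
      rcases mem_insert.1 hw with rfl | hw
      · exact mem_inter.2 ⟨hx, hy⟩
      · simp only [mem_erase] at hw
        exact key z hx hy w hw.2.2 hw.2.1 hw.1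
    have huF : u ∉ F := fun h => huM (hFM h)
    have hins : insert u F = secondSphere G x := by
      refine eq_of_subset_of_card_le (insert_subset hu (hFM.trans inter_subset_left)) ?_
      rw [card_insert_of_notMem huF, hFc, hG.card_secondSphere]
    intro v hv hvu
    rw [← hins] at hv
    exact (mem_inter.1 (hFM ((mem_insert.1 hv).resolve_left hvu))).2
  obtain ⟨hux, a, hxa, hua⟩ := mem_secondSphere.1 hu
  have hc := hG.card_neighbor_inter_secondSphere hxa
  obtain ⟨v, hv, hvu⟩ :=
    exists_mem_ne (show 1 < #(G.neighborFinset a ∩ secondSphere G x) by omega) u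
  simp only [mem_inter, SimpleGraph.mem_neighborFinset] at hv
  have hvM := hMc v hv.2 hvu
  refine huM (key v hv.2 hvM u (hG.mem_of_adj hv.1.symm hua.symm hvu.symm) hux ?_)
  rintro rfl
  exact (hxy hxa hua).1 rfl

/-- The two sides of a regular bipartite graph have the same size. -/
lemma card_compl_of_bipartite (X : Finset V)
    (hX : ∀ a b, G.Adj a b → (a ∈ X ↔ b ∉ X)) : #Xᶜ = #X := by
  have h := Finset.card_mul_eq_card_mul (s := X) (t := Xᶜ)
    (fun a b => G.Adj a b) (m := 2 * m + 1) (n := 2 * m + 1)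
    (fun w hw => by
      rw [← hG.card_nbr w]
      congr 1; ext a
      simp only [mem_bipartiteAbove, mem_compl, SimpleGraph.mem_neighborFinset]
      exact ⟨fun h => h.2, fun h => ⟨(hX _ _ h).1 hw, h⟩⟩)
    (fun w hw => by
      rw [← hG.card_nbr w]
      congr 1; ext a
      simp only [mem_bipartiteBelow, SimpleGraph.mem_neighborFinset]
      exact ⟨fun h => h.2.symm, fun h => ⟨(hX _ _ h.symm).2 (by simpa using hw), h.symm⟩⟩)
  have := Nat.eq_of_mul_eq_mul_right (by omega) h
  exact this.symm

/-- If two far vertices `x`, `y` have the same second sphere `S`, then `{x, y} ∪ S` is one side of a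
bipartition of the graph. -/
lemma isBipartite_of_secondSphere_eq {x y : V} (hconn : G.Connected) (hxy : IsFar G x y)
    (hS : secondSphere G x = secondSphere G y) :
    G.IsBipartite ∧ Fintype.card V = 8 * m + 8 := by
  have hm := hG.two_le
  set X : Finset V := insert x (insert y (secondSphere G x)) with hXdef
  set Y : Finset V := {e | ∃ z ∈ secondSphere G x, G.Adj z e} with hYdef
  have hmY : ∀ {e}, e ∈ Y ↔ ∃ z ∈ secondSphere G x, G.Adj z e := by simp [hYdef]
  have hNY : ∀ w a, secondSphere G w = secondSphere G x → G.Adj w a → a ∈ Y := by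
    intro w a hw ha
    have := hG.card_neighbor_inter_secondSphere ha
    obtain ⟨z, hz⟩ := card_pos.1 (show 0 < #(G.neighborFinset a ∩ secondSphere G w) by omega)
    simp only [mem_inter, SimpleGraph.mem_neighborFinset] at hz
    exact hmY.2 ⟨z, hw ▸ hz.2, hz.1.symm⟩
  have h1 : ∀ a b, a ∈ X → G.Adj a b → b ∈ Y := by
    intro a b ha hab
    simp only [hXdef, mem_insert] at ha
    rcases ha with rfl | rfl | ha
    · exact hNY _ _ rfl hab
    · exact hNY _ _ hS.symm hab
    · exact hmY.2 ⟨a, ha, hab⟩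
  have hstar : ∀ z ∈ secondSphere G x, ∀ e, G.Adj z e → ¬ G.Adj x e → ¬ G.Adj y e →
      e ∉ secondSphere G x ∧ ∀ w, G.Adj e w → w ∈ secondSphere G x := by
    intro z hz e hze hxe hye
    obtain ⟨e', _, _, _, h4, _, h6, h7⟩ := hG.exists_star hxy hz (hS ▸ hz)
    obtain rfl : e = e' := by
      rcases h6 e hze with h | h | h
      exacts [absurd h hxe, absurd h hye, h]
    exact ⟨h4, fun w hw => by rw [← hS] at h7; exact or_self_iff.1 (h7 w hw)⟩
  have h2 : ∀ a b, a ∈ Y → G.Adj a b → b ∈ X := by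
    intro a b ha hab
    simp only [hXdef, mem_insert]
    obtain ⟨z, hz, hza⟩ := hmY.1 ha
    by_cases hxa : G.Adj x a
    · by_cases hb : b = x
      · exact Or.inl hb
      · exact Or.inr (Or.inr (hG.mem_of_adj hxa hab hb))
    by_cases hya : G.Adj y a
    · by_cases hb : b = y
      · exact Or.inr (Or.inl hb)
      · exact Or.inr (Or.inr (hS ▸ hG.mem_of_adj hya hab hb))
    exact Or.inr (Or.inr ((hstar z hz a hza hxa hya).2 b hab))
  have hxS : x ∉ secondSphere G x := by simp [mem_secondSphere]
  have hyS : y ∉ secondSphere G x := by rw [hS]; simp [mem_secondSphere]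
  have hxy' : x ≠ y := by
    rintro rfl
    obtain ⟨a, ha⟩ := hG.exists_adj x
    exact (hxy ha ha).1 rfl
  have h3 : ∀ a ∈ X, a ∉ Y := by
    intro a ha haY
    obtain ⟨z, hz, hza⟩ := hmY.1 haY
    simp only [hXdef, mem_insert] at ha
    rcases ha with rfl | rfl | ha
    · exact hG.not_adj_of_mem hz hza.symm
    · exact hG.not_adj_of_mem (hS ▸ hz) hza.symm
    · refine (hstar z hz a hza (hG.not_adj_of_mem ha) (hG.not_adj_of_mem (hS ▸ ha))).1 ha
  have hcov : ∀ a, a ∈ X ∨ a ∈ Y := by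
    intro a
    obtain ⟨p⟩ := hconn.preconnected x a
    have : ∀ {u v : V} (p : G.Walk u v), (u ∈ X ∨ u ∈ Y) → (v ∈ X ∨ v ∈ Y) := by
      intro u v p
      induction p with
      | nil => exact id
      | cons h _ ih => exact fun hu => ih (hu.elim (fun hu => Or.inr (h1 _ _ hu h))
          (fun hu => Or.inl (h2 _ _ hu h)))
    exact this p (Or.inl (by simp [hXdef]))
  have hX : ∀ a b, G.Adj a b → (a ∈ X ↔ b ∉ X) := fun a b hab =>
    ⟨fun ha hb => h3 b hb (h1 a b ha hab), fun hb => by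
      by_contra ha
      exact hb (h2 a b ((hcov a).resolve_left ha) hab)⟩
  constructor
  · refine ⟨SimpleGraph.Coloring.mk (fun a => if a ∈ X then (0 : Fin 2) else 1) ?_⟩
    intro a b hab
    have := hX a b hab
    by_cases ha : a ∈ X <;> by_cases hb : b ∈ X <;> simp_all
  · have hc := hG.card_compl_of_bipartite X hX
    have hXc : #X = 4 * m + 4 := by
      rw [hXdef, card_insert_of_notMem, card_insert_of_notMem hyS, hG.card_secondSphere]
      simp [hxy', hxS]
    rw [← card_add_card_compl X, hc, hXc]; ring

end IsHalfRegular

/-! ### The hypotheses on distances, and the equitable partition -/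

lemma card_commonNeighbors_eq (x y : V) :
    Fintype.card (G.commonNeighbors x y) = #(G.neighborFinset x ∩ G.neighborFinset y) := by
  rw [← Set.toFinset_card]
  congr 1
  ext a
  simp [SimpleGraph.mem_commonNeighbors]

lemma IsAmplyRegularWith.isHalfRegular {v m : ℕ} (hm : 2 ≤ m) (hconn : G.Connected)
    (h : IsAmplyRegularWith G v (2 * m + 1) 0 m) : IsHalfRegular G m where
  two_le := hm
  card_nbr x := by simpa using h.regular x
  triangle {x y z} hxy hyz hxz := by
    have := h.of_adj x z hxz
    rw [card_commonNeighbors_eq, card_eq_zero, eq_empty_iff_forall_notMem] at this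
    exact this y (by simp [hxy, hyz.symm])
  card_common {x y z} hne hx hy := by
    rw [← card_commonNeighbors_eq]
    apply h.of_dist_two
    refine le_antisymm (SimpleGraph.dist_le (.cons hx (.cons hy.symm .nil))) ?_
    refine hconn.one_lt_dist_of_ne_of_not_adj hne fun hxy => ?_
    have := h.of_adj x y hxy
    rw [card_commonNeighbors_eq, card_eq_zero, eq_empty_iff_forall_notMem] at this
    exact this z (by simp [hx, hy])

lemma diagramMatrix_two_mul_add_one (m : ℕ) : diagramMatrix (2 * m + 1) =
    !![0, 2 * m + 1, 0, 0, 0, 0;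
       1, 0, 2 * m, 0, 0, 0;
       0, m, 0, m, 0, 1;
       0, 0, 2 * m, 0, 1, 0;
       0, 0, 0, 2 * m + 1, 0, 0;
       0, 0, 2 * m + 1, 0, 0, 0] := by
  simp [diagramMatrix]

namespace IsHalfRegular

variable {m : ℕ} (hG : IsHalfRegular G m)

include hG

lemma isFar_iff (hconn : G.Connected) {x y : V} : IsFar G x y ↔ 4 ≤ G.dist x y := by
  constructor
  · intro h
    by_contra! hlt
    obtain ⟨p, hp⟩ := hconn.exists_walk_length_eq_dist x y
    rw [← hp] at hlt
    obtain ⟨a, ha⟩ := hG.exists_adj x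
    cases p with
    | nil => exact (h ha ha).1 rfl
    | cons h1 p =>
      cases p with
      | nil => exact (h ha h1.symm).2 ha.symm
      | cons h2 p =>
        cases p with
        | nil => exact (h h1 h2.symm).1 rfl
        | cons h3 p =>
          cases p with
          | nil => exact (h h1 h3.symm).2 h2
          | cons h4 p => simp only [SimpleGraph.Walk.length_cons] at hlt; omega
  · intro h a b ha hb
    constructor
    · rintro rfl
      have := SimpleGraph.dist_le (SimpleGraph.Walk.cons ha (.cons hb.symm .nil))
      simp only [SimpleGraph.Walk.length_cons, SimpleGraph.Walk.length_nil] at this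
      omega
    · intro hab
      have := SimpleGraph.dist_le (SimpleGraph.Walk.cons ha (.cons hab (.cons hb.symm .nil)))
      simp only [SimpleGraph.Walk.length_cons, SimpleGraph.Walk.length_nil] at this
      omega

/-- Two vertices at distance exactly four have a midpoint. -/
lemma exists_mid (hconn : G.Connected) {x y : V} (hd : G.dist x y = 4) :
    ∃ z, z ∈ secondSphere G x ∧ z ∈ secondSphere G y := by
  have hf := (hG.isFar_iff hconn).2 hd.ge
  obtain ⟨p, hp⟩ := hconn.exists_walk_length_eq_dist x y
  rw [hd] at hp
  match p, hp with
  | .cons (v := a) h1 (.cons (v := z) h2 (.cons (v := b) h3 (.cons h4 .nil))), _ =>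
    refine ⟨z, hG.mem_of_adj h1 h2 ?_, hG.mem_of_adj h4.symm h3.symm ?_⟩
    · rintro rfl; exact (hf h3 h4.symm).1 rfl
    · rintro rfl; exact (hf h1 h2.symm).1 rfl

/-- In the bipartite case with `8 * m + 8` vertices, each vertex has exactly one other vertex on its
side outside its second sphere. -/
lemma exists_antipode (c : G.Coloring Bool) (hcard : Fintype.card V = 8 * m + 8) (x : V) :
    ∃ y, y ≠ x ∧ y ∉ secondSphere G x ∧ c y = c x ∧
      ∀ w, c w = c x → w = x ∨ w = y ∨ w ∈ secondSphere G x := by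
  set X : Finset V := {w | c w = c x} with hX
  have hXc : #X = 4 * m + 4 := by
    have h1 := hG.card_compl_of_bipartite X (fun a b hab => by
      have := c.valid hab
      simp only [hX, mem_filter, mem_univ, true_and]
      cases h1 : c a <;> cases h2 : c b <;> cases c x <;> simp_all)
    have h2 := card_add_card_compl X
    omega
  have hsub : insert x (secondSphere G x) ⊆ X := by
    intro w hw
    simp only [hX, mem_filter, mem_univ, true_and]
    rcases mem_insert.1 hw with rfl | hw
    · rfl
    · obtain ⟨_, a, h1, h2⟩ := mem_secondSphere.1 hw
      have := c.valid h1
      have := c.valid h2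
      cases h1 : c a <;> cases h2 : c x <;> cases h3 : c w <;> simp_all
  have hx : x ∉ secondSphere G x := by simp [mem_secondSphere]
  have h1 : #(X \ insert x (secondSphere G x)) = 1 := by
    rw [card_sdiff_of_subset hsub, card_insert_of_notMem hx, hG.card_secondSphere]
    omega
  obtain ⟨y, hy⟩ := card_eq_one.1 h1
  have hmem : ∀ w, (c w = c x ∧ w ≠ x ∧ w ∉ secondSphere G x) ↔ w = y := by
    intro w
    have := Finset.ext_iff.1 hy w
    simpa only [hX, mem_sdiff, mem_filter, mem_univ, true_and, mem_insert, not_or,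
      mem_singleton] using this
  obtain ⟨h2, h3, h4⟩ := (hmem y).2 rfl
  refine ⟨y, h3, h4, h2, fun w hw => ?_⟩
  by_contra! h
  exact h.2.1 ((hmem w).1 ⟨hw, h.1, h.2.2⟩)

lemma existsUnique_dist_eq_four (hconn : G.Connected) (hdiam : ∀ u v, G.dist u v ≤ 4)
    (c : G.Coloring Bool) (hcard : Fintype.card V = 8 * m + 8) (x : V) :
    ∃! y, G.dist x y = 4 := by
  have hpar : ∀ w, Even (G.dist x w) ↔ c w = c x := by
    intro w
    obtain ⟨p, hp⟩ := hconn.exists_walk_length_eq_dist x w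
    rw [← hp, c.even_length_iff_congr p, ← Bool.eq_iff_iff, eq_comm]
  obtain ⟨y, h1, h2, h3, h4⟩ := hG.exists_antipode c hcard x
  have hd2 : ∀ {w}, w ∈ secondSphere G x → G.dist x w ≤ 2 := by
    intro w hw
    obtain ⟨_, a, h1, h2⟩ := mem_secondSphere.1 hw
    exact SimpleGraph.dist_le (.cons h1 (.cons h2.symm .nil))
  refine ⟨y, ?_, ?_⟩
  · by_contra hne
    have he := (hpar y).2 h3
    have hle := hdiam x y
    have h0 : G.dist x y ≠ 0 := fun h => h1 (hconn.dist_eq_zero_iff.1 h).symm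
    have h2' : G.dist x y = 2 := by
      obtain ⟨r, hr⟩ := he
      omega
    obtain ⟨p, hp⟩ := hconn.exists_walk_length_eq_dist x y
    rw [h2'] at hp
    match p, hp with
    | .cons (v := a) h5 (.cons h6 .nil), _ => exact h2 (hG.mem_of_adj h5 h6 h1)
  · intro w hw
    rcases h4 w ((hpar w).1 (by rw [hw]; decide)) with rfl | h | h
    · simp at hw
    · exact h
    · have := hd2 h
      omega

/-- The equitable partition: `x`, its neighbours, its second sphere, which is also that of its
antipode `y`, the neighbours of `y`, the vertex `y`, and the rest. -/
lemma isQRegular (c : G.Coloring Bool) (hcard : Fintype.card V = 8 * m + 8) :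
    IsQRegularWithDiagram G (diagramSizes (2 * m + 1)) (diagramMatrix (2 * m + 1)) := by
  intro x
  obtain ⟨y, hyx, hyS, hcy, hall⟩ := hG.exists_antipode c hcard x
  have hadj : ∀ {a b}, G.Adj a b → c b = !c a := by
    intro a b hab
    have := c.valid hab
    cases h1 : c a <;> cases h2 : c b <;> simp_all
  have hcS : ∀ {u w}, w ∈ secondSphere G u → c w = c u := by
    intro u w hw
    obtain ⟨_, a, h1, h2⟩ := mem_secondSphere.1 hw
    have h3 := hadj h1
    rw [hadj h2] at h3
    simpa using h3
  have hSS : secondSphere G x = secondSphere G y := by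
    refine (eq_of_subset_of_card_le ?_ (by rw [hG.card_secondSphere, hG.card_secondSphere])).symm
    intro w hw
    rcases hall w ((hcS hw).trans hcy) with rfl | rfl | h
    · exact absurd (mem_secondSphere_comm.1 hw) hyS
    · exact absurd rfl (mem_secondSphere.1 hw).1
    · exact h
  have hdisj : ∀ {a}, G.Adj x a → ¬ G.Adj y a := fun h1 h2 =>
    hyS (hG.mem_of_adj h1 h2.symm hyx)
  have hxS : x ∉ secondSphere G x := by simp [mem_secondSphere]
  have hcx : ∀ {w}, G.Adj x w → c w ≠ c x := fun h => by rw [hadj h]; simp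
  have hcy' : ∀ {w}, G.Adj y w → c w ≠ c x := fun h => by rw [hadj h, hcy]; simp
  have hBex : ∀ w, ∃ i : Fin 6, (i = 0 ↔ w = x) ∧ (i = 1 ↔ G.Adj x w) ∧
      (i = 2 ↔ w ∈ secondSphere G x) ∧ (i = 3 ↔ G.Adj y w) ∧ (i = 4 ↔ w = y) ∧
      (i = 5 ↔ c w ≠ c x ∧ ¬ G.Adj x w ∧ ¬ G.Adj y w) := by
    intro w
    by_cases hc : c w = c x
    · have h1 : ¬ G.Adj x w := fun h => hcx h hc
      have h3 : ¬ G.Adj y w := fun h => hcy' h hc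
      rcases hall w hc with h | h | h
      · subst h; exact ⟨0, by simp [hxS, h3, Ne.symm hyx]⟩
      · subst h; exact ⟨4, by simp [hyS, h1, hyx, hc]⟩
      · have h0 : w ≠ x := fun h' => hxS (h' ▸ h)
        have h4 : w ≠ y := fun h' => hyS (h' ▸ h)
        exact ⟨2, by simp [h0, h1, h, h3, h4, hc]⟩
    · have h0 : w ≠ x := fun h' => hc (h' ▸ rfl)
      have h4 : w ≠ y := fun h' => hc (h' ▸ hcy)
      have h2 : w ∉ secondSphere G x := fun h' => hc (hcS h')
      by_cases h1 : G.Adj x w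
      · exact ⟨1, by simp [h0, h1, h2, hdisj h1, h4]⟩
      by_cases h3 : G.Adj y w
      · exact ⟨3, by simp [h0, h1, h2, h3, h4]⟩
      · exact ⟨5, by simp [h0, h1, h2, h3, h4, hc]⟩
  choose B hB0 hB1 hB2 hB3 hB4 hB5 using hBex
  have hcB : ∀ w, c w = c x → B w = 0 ∨ B w = 2 ∨ B w = 4 := by
    intro w hw
    rw [hB0, hB2, hB4]
    rcases hall w hw with h | h | h <;> simp [h]
  have hcB' : ∀ w, c w ≠ c x → B w = 1 ∨ B w = 3 ∨ B w = 5 := by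
    intro w hw
    rw [hB1, hB3, hB5]
    tauto
  -- sizes of the parts of `B` and of their intersections with neighbourhoods
  have hfe : ∀ (u : V) (j : Fin 6), Fintype.card {w : V // G.Adj u w ∧ B w = j} =
      #{w ∈ G.neighborFinset u | B w = j} := by
    intro u j
    rw [Fintype.card_subtype]
    congr 1; ext w; simp
  have hempty : ∀ (u : V) (j : Fin 6), (∀ w, G.Adj u w → B w ≠ j) →
      #{w ∈ G.neighborFinset u | B w = j} = 0 := by
    intro u j h
    rw [card_eq_zero, filter_eq_empty_iff]
    intro w hw
    exact h w (by simpa using hw)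
  have hfull : ∀ (u : V) (j : Fin 6), (∀ w, G.Adj u w → B w = j) →
      #{w ∈ G.neighborFinset u | B w = j} = 2 * m + 1 := by
    intro u j h
    rw [filter_true_of_mem (fun w hw => h w (by simpa using hw)), hG.card_nbr]
  have hsame : ∀ (u w : V), c u = c x → G.Adj u w → B w = 1 ∨ B w = 3 ∨ B w = 5 :=
    fun u w hu h => hcB' w (by rw [hadj h, hu]; simp)
  have hdiff : ∀ (u w : V), c u ≠ c x → G.Adj u w → B w = 0 ∨ B w = 2 ∨ B w = 4 :=
    fun u w hu h => hcB w (by rw [hadj h]; cases h1 : c u <;> cases h2 : c x <;> simp_all)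
  have hsum : ∀ u, #{w ∈ G.neighborFinset u | B w = 0} + #{w ∈ G.neighborFinset u | B w = 1} +
      #{w ∈ G.neighborFinset u | B w = 2} + #{w ∈ G.neighborFinset u | B w = 3} +
      #{w ∈ G.neighborFinset u | B w = 4} + #{w ∈ G.neighborFinset u | B w = 5} = 2 * m + 1 := by
    intro u
    have := card_eq_sum_card_fiberwise (f := B) (s := G.neighborFinset u) (t := univ) (by simp)
    rw [hG.card_nbr, Fin.sum_univ_six] at this
    exact this.symm
  have hone : ∀ (u a : V) (j : Fin 6), (∀ w, B w = j ↔ w = a) → G.Adj u a →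
      #{w ∈ G.neighborFinset u | B w = j} = 1 := by
    intro u a j h hua
    rw [card_eq_one]
    exact ⟨a, by ext w; simp only [mem_filter, h, mem_singleton, SimpleGraph.mem_neighborFinset]
                 exact ⟨fun h => h.2, fun h => ⟨h ▸ hua, h⟩⟩⟩
  have hS2 : ∀ u ∈ secondSphere G x, ∀ (a : V) (j : Fin 6), u ∈ secondSphere G a →
      (∀ w, B w = j ↔ G.Adj a w) → #{w ∈ G.neighborFinset u | B w = j} = m := by
    intro u _ a j hua h
    rw [← hG.card_inter hua]
    congr 1; ext w; simp [h]
  have hN2 : ∀ u a, G.Adj a u → secondSphere G a = secondSphere G x →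
      #{w ∈ G.neighborFinset u | B w = 2} = 2 * m := by
    intro u a hau ha
    rw [← hG.card_neighbor_inter_secondSphere hau]
    congr 1; ext w; simp [hB2, ha]
  have hB4' : ∀ w, B w = 4 ↔ w = y := fun w => by rw [← hB4 w, eq_comm]
  have hsize : ∀ i, Fintype.card {w : V // B w = i} = diagramSizes (2 * m + 1) i := by
    intro i
    rw [Fintype.card_subtype]
    have hs := card_eq_sum_card_fiberwise (f := B) (s := univ) (t := univ) (by simp)
    rw [card_univ, hcard, Fin.sum_univ_six] at hs
    have g0 : #{w | B w = 0} = 1 := card_eq_one.2 ⟨x, by ext w; simp [hB0]⟩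
    have g1 : #{w | B w = 1} = 2 * m + 1 := by
      rw [← hG.card_nbr x]; congr 1; ext w; simp [hB1]
    have g2 : #{w | B w = 2} = 4 * m + 2 := by
      rw [← hG.card_secondSphere x]; congr 1; ext w; simp [hB2]
    have g3 : #{w | B w = 3} = 2 * m + 1 := by
      rw [← hG.card_nbr y]; congr 1; ext w; simp [hB3]
    have g4 : #{w | B w = 4} = 1 := card_eq_one.2 ⟨y, by ext w; simp [hB4']⟩
    have g5 : #{w | B w = 5} = 2 := by omega
    fin_cases i
    exacts [g0, g1, g2.trans (show 4 * m + 2 = 2 * (2 * m + 1) by ring), g3, g4, g5]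
  refine ⟨B, ⟨?_, hsize, ?_⟩, 0, hB0⟩
  · intro i
    have : 0 < Fintype.card {w : V // B w = i} := by
      rw [hsize]; fin_cases i <;> simp [diagramSizes]
    obtain ⟨w, hw⟩ := Fintype.card_pos_iff.1 this
    exact ⟨w, hw⟩
  · intro u j
    rw [hfe]
    have hQ := diagramMatrix_two_mul_add_one m
    set Q := diagramMatrix (2 * m + 1)
    have hs := hsum u
    obtain ⟨r0, r1, r2, r3, r4, r5⟩ :
        #{w ∈ G.neighborFinset u | B w = 0} = Q (B u) 0 ∧
        #{w ∈ G.neighborFinset u | B w = 1} = Q (B u) 1 ∧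
        #{w ∈ G.neighborFinset u | B w = 2} = Q (B u) 2 ∧
        #{w ∈ G.neighborFinset u | B w = 3} = Q (B u) 3 ∧
        #{w ∈ G.neighborFinset u | B w = 4} = Q (B u) 4 ∧
        #{w ∈ G.neighborFinset u | B w = 5} = Q (B u) 5 := by
      by_cases hu : c u = c x
      · have hd := fun w => hsame u w hu
        have g0 := hempty u 0 (fun w hw h => by have := hd w hw; simp [h] at this)
        have g2 := hempty u 2 (fun w hw h => by have := hd w hw; simp [h] at this)
        have g4 := hempty u 4 (fun w hw h => by have := hd w hw; simp [h] at this)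
        rcases hcB u hu with h | h | h
        · have h' := (hB0 u).1 h
          have g1 := hfull u 1 (fun w hw => (hB1 w).2 (h' ▸ hw))
          rw [h, hQ]
          simp only [g0, g1, g2, g4] at hs ⊢
          refine ⟨?_, ?_, ?_, ?_, ?_, ?_⟩ <;> simp [-card_eq_zero] <;> omega
        · have h' := (hB2 u).1 h
          have g1 := hS2 u h' x 1 h' hB1
          have g3 := hS2 u h' y 3 (hSS ▸ h') hB3
          rw [h, hQ]
          simp only [g0, g1, g2, g3, g4] at hs ⊢
          refine ⟨?_, ?_, ?_, ?_, ?_, ?_⟩ <;> simp [-card_eq_zero] <;> omega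
        · have h' := (hB4' u).1 h
          have g3 := hfull u 3 (fun w hw => (hB3 w).2 (h' ▸ hw))
          rw [h, hQ]
          simp only [g0, g3, g2, g4] at hs ⊢
          refine ⟨?_, ?_, ?_, ?_, ?_, ?_⟩ <;> simp [-card_eq_zero] <;> omega
      · have hd := fun w => hdiff u w hu
        have g1 := hempty u 1 (fun w hw h => by have := hd w hw; simp [h] at this)
        have g3 := hempty u 3 (fun w hw h => by have := hd w hw; simp [h] at this)
        have g5 := hempty u 5 (fun w hw h => by have := hd w hw; simp [h] at this)
        rcases hcB' u hu with h | h | h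
        · have h' := (hB1 u).1 h
          have g0 := hone u x 0 hB0 h'.symm
          have g2 := hN2 u x h' rfl
          rw [h, hQ]
          simp only [g0, g1, g2, g3, g5] at hs ⊢
          refine ⟨?_, ?_, ?_, ?_, ?_, ?_⟩ <;> simp [-card_eq_zero] <;> omega
        · have h' := (hB3 u).1 h
          have g4 := hone u y 4 hB4' h'.symm
          have g2 := hN2 u y h' hSS.symm
          rw [h, hQ]
          simp only [g4, g1, g2, g3, g5] at hs ⊢
          refine ⟨?_, ?_, ?_, ?_, ?_, ?_⟩ <;> simp [-card_eq_zero] <;> omega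
        · have h' := (hB5 u).1 h
          have g2 := hfull u 2 (fun w hw => by
            rcases hd w hw with h1 | h1 | h1
            · exact absurd ((hB0 w).1 h1 ▸ hw).symm h'.2.1
            · exact h1
            · exact absurd ((hB4' w).1 h1 ▸ hw).symm h'.2.2)
          rw [h, hQ]
          simp only [g1, g2, g3, g5] at hs ⊢
          refine ⟨?_, ?_, ?_, ?_, ?_, ?_⟩ <;> simp [-card_eq_zero] <;> omega
    fin_cases j
    exacts [r0, r1, r2, r3, r4, r5]

end IsHalfRegular

/-- The part sizes add up to `4 * k + 4`. -/
lemma IsQRegularWithDiagram.card_eq [Nonempty V] {k : ℕ}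
    (h : IsQRegularWithDiagram G (diagramSizes k) (diagramMatrix k)) :
    Fintype.card V = 4 * k + 4 := by
  obtain ⟨B, hB, -⟩ := h (Classical.arbitrary V)
  have hs := card_eq_sum_card_fiberwise (f := B) (s := univ) (t := univ) (by simp)
  rw [card_univ, Fin.sum_univ_six] at hs
  simp_rw [← Fintype.card_subtype, hB.size] at hs
  rw [hs]
  simp [diagramSizes]
  ring

/-! ### Rectagraphs and labels around a vertex -/

/-- An injective homomorphism into a connected graph that does not increase degrees is an
isomorphism. -/
lemma nonempty_iso_of_injective_hom {W : Type*} [Fintype W] [Nonempty W]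
    (L : SimpleGraph W) [DecidableRel L.Adj] (f : W → V) (hinj : Function.Injective f)
    (hadj : ∀ a b, L.Adj a b → G.Adj (f a) (f b)) (hdeg : ∀ a, G.degree (f a) ≤ L.degree a)
    (hconn : G.Connected) : Nonempty (G ≃g L) := by
  classical
  have himg : ∀ a, (L.neighborFinset a).image f = G.neighborFinset (f a) := by
    intro a
    refine eq_of_subset_of_card_le ?_ ?_
    · intro u hu
      obtain ⟨b, hb, rfl⟩ := mem_image.1 hu
      simpa using hadj a b (by simpa using hb)
    · rw [card_image_of_injective _ hinj]
      simpa using hdeg a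
  have hback : ∀ a u, G.Adj (f a) u → ∃ b, L.Adj a b ∧ f b = u := by
    intro a u h
    have : u ∈ (L.neighborFinset a).image f := by rw [himg]; simpa using h
    obtain ⟨b, hb, rfl⟩ := mem_image.1 this
    exact ⟨b, by simpa using hb, rfl⟩
  have hsurj : Function.Surjective f := by
    intro v
    have : ∀ {u w : V} (p : G.Walk u w), u ∈ Set.range f → w ∈ Set.range f := by
      intro u w p
      induction p with
      | nil => exact id
      | cons h _ ih =>
        rintro ⟨a, rfl⟩
        obtain ⟨b, -, hb⟩ := hback a _ h
        exact ih ⟨b, hb⟩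
    obtain ⟨p⟩ := hconn.preconnected (f (Classical.arbitrary W)) v
    exact this p ⟨_, rfl⟩
  refine ⟨SimpleGraph.Iso.symm ⟨Equiv.ofBijective f ⟨hinj, hsurj⟩, ?_⟩⟩
  intro a b
  refine ⟨fun h => ?_, hadj a b⟩
  obtain ⟨b', hb', he⟩ := hback a _ h
  rwa [← hinj he]

/-- A rectagraph: a triangle-free graph in which two distinct vertices with a common neighbour have
exactly two common neighbours. -/
structure IsRectagraph {V : Type*} (G : SimpleGraph V) : Prop where
  triangle : ∀ {x y z}, G.Adj x y → G.Adj y z → ¬ G.Adj x z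
  square : ∀ {x y z}, x ≠ y → G.Adj x z → G.Adj y z →
    ∃ w, w ≠ z ∧ G.Adj x w ∧ G.Adj y w ∧ ∀ u, G.Adj x u → G.Adj y u → u = z ∨ u = w

lemma exists_square_of_card_eq_two {x y z : V} (hx : G.Adj x z) (hy : G.Adj y z)
    (h : #(G.neighborFinset x ∩ G.neighborFinset y) = 2) :
    ∃ w, w ≠ z ∧ G.Adj x w ∧ G.Adj y w ∧ ∀ u, G.Adj x u → G.Adj y u → u = z ∨ u = w := by
  have hz : z ∈ G.neighborFinset x ∩ G.neighborFinset y := by simp [hx, hy]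
  have h1 : #((G.neighborFinset x ∩ G.neighborFinset y).erase z) = 1 := by
    rw [card_erase_of_mem hz, h]
  obtain ⟨w, hw⟩ := card_eq_one.1 h1
  have hmem : ∀ u, (u ≠ z ∧ G.Adj x u ∧ G.Adj y u) ↔ u = w := by
    intro u
    have := Finset.ext_iff.1 hw u
    simpa only [mem_erase, mem_inter, SimpleGraph.mem_neighborFinset, mem_singleton] using this
  obtain ⟨h2, h3, h4⟩ := (hmem w).2 rfl
  refine ⟨w, h2, h3, h4, fun u hu hu' => ?_⟩
  by_cases hz : u = z
  · exact Or.inl hz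
  · exact Or.inr ((hmem u).1 ⟨hz, hu, hu'⟩)

lemma IsHalfRegular.isRectagraph (hG : IsHalfRegular G 2) : IsRectagraph G where
  triangle := hG.triangle
  square hne hx hy := exists_square_of_card_eq_two hx hy (hG.card_common hne hx hy)

/-- Labels around a vertex `x` of a rectagraph: the neighbours of `x` are the vertices `a i`, and
`P i j` is the common neighbour of `a i` and `a j` other than `x`. The values `P i i` are
irrelevant. -/
structure IsFrame {V : Type*} (G : SimpleGraph V) {n : ℕ} (x : V) (a : Fin n → V)
    (P : Fin n → Fin n → V) : Prop where
  inj : Function.Injective a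
  adj : ∀ i, G.Adj x (a i)
  eq_of_adj : ∀ {w}, G.Adj x w → ∃ i, w = a i
  ne : ∀ {i j}, i ≠ j → P i j ≠ x
  symm : ∀ i j, P i j = P j i
  adj_left : ∀ {i j}, i ≠ j → G.Adj (a i) (P i j)
  eq_of_adj_adj : ∀ {i j w}, i ≠ j → G.Adj (a i) w → G.Adj (a j) w → w = x ∨ w = P i j

lemma IsRectagraph.exists_frame (hG : IsRectagraph G) {n : ℕ} (x : V) (hx : G.degree x = n) :
    ∃ (a : Fin n → V) (P : Fin n → Fin n → V), IsFrame G x a P := by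
  let e : Fin n ≃ G.neighborFinset x := ((G.neighborFinset x).equivFinOfCardEq hx).symm
  have hadj : ∀ i, G.Adj x (e i) := fun i => (G.mem_neighborFinset _ _).1 (e i).2
  have hinj : Function.Injective fun i => (e i : V) :=
    Subtype.val_injective.comp e.injective
  have hex : ∀ i j, ∃ p, i ≠ j → (p ≠ x ∧ G.Adj (e i) p ∧ G.Adj (e j) p ∧
      ∀ w, G.Adj (e i) w → G.Adj (e j) w → w = x ∨ w = p) := by
    intro i j
    by_cases h : i = j
    · exact ⟨x, fun h' => absurd h h'⟩
    · obtain ⟨p, hp⟩ := hG.square (hinj.ne h) (hadj i).symm (hadj j).symm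
      exact ⟨p, fun _ => hp⟩
  choose P hP using hex
  have hsymm : ∀ i j, i ≠ j → P i j = P j i := fun i j h =>
    ((hP j i h.symm).2.2.2 _ (hP i j h).2.2.1 (hP i j h).2.1).resolve_left (hP i j h).1
  exact ⟨fun i => e i, P, {
    inj := hinj
    adj := hadj
    eq_of_adj := fun {w} hw =>
      ⟨e.symm ⟨w, by simpa using hw⟩, by simp⟩
    ne := fun h => (hP _ _ h).1
    symm := fun i j => by
      by_cases h : i = j
      · rw [h]
      · exact hsymm i j h
    adj_left := fun h => (hP _ _ h).2.1
    eq_of_adj_adj := fun h h1 h2 => (hP _ _ h).2.2.2 _ h1 h2 }⟩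

namespace IsFrame

variable {n : ℕ} {x : V} {a : Fin n → V} {P : Fin n → Fin n → V}

/-- The labels can be permuted. -/
lemma comp (F : IsFrame G x a P) (σ : Equiv.Perm (Fin n)) :
    IsFrame G x (a ∘ σ) (fun i j => P (σ i) (σ j)) where
  inj := F.inj.comp σ.injective
  adj i := F.adj _
  eq_of_adj hw := by
    obtain ⟨i, rfl⟩ := F.eq_of_adj hw
    exact ⟨σ.symm i, by simp⟩
  ne h := F.ne (σ.injective.ne h)
  symm i j := F.symm _ _
  adj_left h := F.adj_left (σ.injective.ne h)
  eq_of_adj_adj h h1 h2 := F.eq_of_adj_adj (σ.injective.ne h) h1 h2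

variable (hG : IsRectagraph G) (F : IsFrame G x a P)

include F in
lemma adj_right {i j : Fin n} (h : i ≠ j) : G.Adj (a j) (P i j) := by
  rw [F.symm]; exact F.adj_left h.symm

include hG F

lemma eq_or_eq {i j l : Fin n} (h : i ≠ j) (hl : G.Adj (a l) (P i j)) : l = i ∨ l = j := by
  obtain ⟨w, hw, _, _, h4⟩ := hG.square (F.ne h).symm (F.adj i) (F.adj_left h).symm
  have hj := (h4 _ (F.adj j) (F.adj_right h).symm).resolve_left (F.inj.ne h.symm)
  rcases h4 _ (F.adj l) hl.symm with h5 | h5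
  · exact Or.inl (F.inj h5)
  · exact Or.inr (F.inj (h5.trans hj.symm))

lemma eq_and_eq {i j k l : Fin n} (h : i ≠ j) (h' : k ≠ l) (he : P i j = P k l) :
    (i = k ∧ j = l) ∨ (i = l ∧ j = k) := by
  have h1 := F.eq_or_eq hG h' (he ▸ F.adj_left h)
  have h2 := F.eq_or_eq hG h' (he ▸ F.adj_right h)
  rcases h1 with rfl | rfl <;> rcases h2 with rfl | rfl <;> simp_all

lemma exists_eq {i : Fin n} {w : V} (h : G.Adj (a i) w) (hw : w ≠ x) : ∃ j, i ≠ j ∧ w = P i j := by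
  obtain ⟨b, hb, hwb, hxb, -⟩ := hG.square hw h.symm (F.adj i)
  obtain ⟨j, rfl⟩ := F.eq_of_adj hxb
  have hij : i ≠ j := by rintro rfl; exact hb rfl
  exact ⟨j, hij, (F.eq_of_adj_adj hij h hwb.symm).resolve_left hw⟩

/-- The vertices `P i j` adjacent to a vertex `e` outside the neighbourhood of `x` form, as edges
`ij` of a graph on the labels, a graph with degrees zero or two. -/
lemma exists_next {i j : Fin n} {e : V} (he : ¬ G.Adj x e) (hij : i ≠ j) (h : G.Adj e (P i j)) :
    ∃ k, k ≠ i ∧ k ≠ j ∧ G.Adj e (P i k) ∧ ∀ l, i ≠ l → G.Adj e (P i l) → l = j ∨ l = k := by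
  have hne : e ≠ a i := by rintro rfl; exact he (F.adj i)
  obtain ⟨w, hw, hew, hiw, hall⟩ := hG.square hne h (F.adj_left hij)
  have hwx : w ≠ x := by rintro rfl; exact he hew.symm
  obtain ⟨k, hik, rfl⟩ := F.exists_eq hG hiw hwx
  refine ⟨k, hik.symm, by rintro rfl; exact hw rfl, hew, fun l hl hel => ?_⟩
  rcases hall _ hel (F.adj_left hl) with h1 | h1
  · rcases F.eq_and_eq hG hl hij h1 with h2 | h2
    · exact Or.inl h2.2
    · exact absurd h2.1 hij
  · rcases F.eq_and_eq hG hl hik h1 with h2 | h2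
    · exact Or.inr h2.2
    · exact absurd h2.1 hik

lemma not_three (i j k l : Fin n) {e : V} (he : ¬ G.Adj x e) (hj : G.Adj e (P i j))
    (hk : G.Adj e (P i k)) (hl : G.Adj e (P i l)) (hij : i ≠ j := by decide)
    (hik : i ≠ k := by decide) (hil : i ≠ l := by decide) (hjk : j ≠ k := by decide)
    (hjl : j ≠ l := by decide) (hkl : k ≠ l := by decide) : False := by
  obtain ⟨m, _, _, _, h⟩ := F.exists_next hG he hij hj
  have h1 := (h k hik hk).resolve_left hjk.symm
  have h2 := (h l hil hl).resolve_left hjl.symm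
  exact hkl (h1.trans h2.symm)

lemma not_three_right (i j k l : Fin n) {e : V} (he : ¬ G.Adj x e) (hj : G.Adj e (P j i))
    (hk : G.Adj e (P k i)) (hl : G.Adj e (P l i)) (hij : i ≠ j := by decide)
    (hik : i ≠ k := by decide) (hil : i ≠ l := by decide) (hjk : j ≠ k := by decide)
    (hjl : j ≠ l := by decide) (hkl : k ≠ l := by decide) : False :=
  F.not_three hG i j k l he (by rwa [F.symm]) (by rwa [F.symm]) (by rwa [F.symm])
    hij hik hil hjk hjl hkl

/-- The common neighbour of `P i j` and `P i k` other than `a i`. -/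
lemma exists_corner {i j k : Fin n} (hij : i ≠ j) (hik : i ≠ k) (hjk : j ≠ k) :
    ∃ g, ¬ G.Adj x g ∧ G.Adj g (P i j) ∧ G.Adj g (P i k) ∧
      ∀ h, G.Adj h (P i j) → G.Adj h (P i k) → h = a i ∨ h = g := by
  have hne : P i j ≠ P i k := fun h => by
    rcases F.eq_and_eq hG hij hik h with h | h
    · exact hjk h.2
    · exact hik h.1
  obtain ⟨g, h1, h2, h3, h4⟩ := hG.square hne (F.adj_left hij).symm (F.adj_left hik).symm
  refine ⟨g, fun h => ?_, h2.symm, h3.symm, fun u hu hu' => h4 u hu.symm hu'.symm⟩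
  obtain ⟨l, rfl⟩ := F.eq_of_adj h
  have h5 := F.eq_or_eq hG hij h2.symm
  have h6 := F.eq_or_eq hG hik h3.symm
  rcases h5 with rfl | rfl
  · exact h1 rfl
  · rcases h6 with rfl | rfl
    · exact h1 rfl
    · exact hjk rfl

end IsFrame

/-- The labelling of the points and blocks of `Λ` by a point `r`, the four blocks `n i` through it,
the six points `q i j` other than `r`, with `q i j` on `n i` and `n j`, and the three blocks
missing `r`. -/
def lambdaLabel {W : Type*} (r : W) (n : Fin 4 → W) (q : Fin 4 → Fin 4 → W) (c₁ c₂ c₃ : W) :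
    Fin 7 ⊕ Fin 7 → W :=
  Sum.elim ![r, q 1 2, q 2 3, q 0 3, q 1 3, q 0 2, q 0 1] ![n 0, n 1, n 2, c₂, n 3, c₁, c₃]

instance : DecidableRel lambdaGraph.Adj := by unfold lambdaGraph; infer_instance

/-- The incidences between the labels of `lambdaLabel`: the `i`-th of the blocks `c₁`, `c₂`, `c₃`
misses `r` and the two points given by the `i`-th partition `01|23`, `02|13`, `03|12`. -/
structure IsLambdaLabelling {W : Type*} (R : W → W → Prop) (r : W) (n : Fin 4 → W)
    (q : Fin 4 → Fin 4 → W) (c₁ c₂ c₃ : W) : Prop where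
  root : ∀ i, R r (n i)
  left : ∀ {i j}, i < j → R (q i j) (n i)
  right : ∀ {i j}, i < j → R (q i j) (n j)
  first : R (q 0 2) c₁ ∧ R (q 0 3) c₁ ∧ R (q 1 2) c₁ ∧ R (q 1 3) c₁
  second : R (q 0 1) c₂ ∧ R (q 0 3) c₂ ∧ R (q 1 2) c₂ ∧ R (q 2 3) c₂
  third : R (q 0 1) c₃ ∧ R (q 0 2) c₃ ∧ R (q 1 3) c₃ ∧ R (q 2 3) c₃

lemma IsLambdaLabelling.rel {W : Type*} {R : W → W → Prop} {r : W} {n : Fin 4 → W}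
    {q : Fin 4 → Fin 4 → W} {c₁ c₂ c₃ : W} (h : IsLambdaLabelling R r n q c₁ c₂ c₃)
    (p b : Fin 7) (hpb : lambdaIncidence p b) :
    R (lambdaLabel r n q c₁ c₂ c₃ (.inl p)) (lambdaLabel r n q c₁ c₂ c₃ (.inr b)) := by
  obtain ⟨h0, h1, h2, ⟨a1, a2, a3, a4⟩, ⟨b1, b2, b3, b4⟩, ⟨d1, d2, d3, d4⟩⟩ := h
  have l01 := @h1 0 1 (by decide)
  have l02 := @h1 0 2 (by decide)
  have l03 := @h1 0 3 (by decide)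
  have l12 := @h1 1 2 (by decide)
  have l13 := @h1 1 3 (by decide)
  have l23 := @h1 2 3 (by decide)
  have r01 := @h2 0 1 (by decide)
  have r02 := @h2 0 2 (by decide)
  have r03 := @h2 0 3 (by decide)
  have r12 := @h2 1 2 (by decide)
  have r13 := @h2 1 3 (by decide)
  have r23 := @h2 2 3 (by decide)
  have n0 := h0 0
  have n1 := h0 1
  have n2 := h0 2
  have n3 := h0 3
  fin_cases p <;> fin_cases b <;> first | assumption | exact absurd hpb (by decide)

lemma injective_vec7 {W : Type*} {a b c d e f g : W} (h : [a, b, c, d, e, f, g].Nodup) :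
    Function.Injective ![a, b, c, d, e, f, g] := by
  have : [a, b, c, d, e, f, g] = List.ofFn ![a, b, c, d, e, f, g] := by simp [List.ofFn_succ]
  rw [this] at h
  exact List.nodup_ofFn.1 h

/-! ### The uniqueness of `Λ` -/

lemma IsFrame.label_ne {n : ℕ} {x : V} {a : Fin n → V} {P : Fin n → Fin n → V}
    (hG : IsRectagraph G) (F : IsFrame G x a P) {i j k l : Fin n} (h : i ≠ j) (h' : k ≠ l)
    (hne : ¬ ((i = k ∧ j = l) ∨ (i = l ∧ j = k))) : P i j ≠ P k l :=
  fun he => hne (F.eq_and_eq hG h h' he)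

lemma lambdaLabel_injective {W : Type*} {r : W} {n : Fin 4 → W} {q : Fin 4 → Fin 4 → W}
    {c₁ c₂ c₃ : W} (h1 : [r, q 1 2, q 2 3, q 0 3, q 1 3, q 0 2, q 0 1].Nodup)
    (h2 : [n 0, n 1, n 2, c₂, n 3, c₁, c₃].Nodup)
    (h3 : ∀ p b, lambdaLabel r n q c₁ c₂ c₃ (.inl p) ≠ lambdaLabel r n q c₁ c₂ c₃ (.inr b)) :
    Function.Injective (lambdaLabel r n q c₁ c₂ c₃) :=
  (injective_vec7 h1).sumElim (injective_vec7 h2) h3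

/-- A connected bipartite rectagraph of valency four with `14` vertices is `Λ`: each half has seven
vertices, so the half of a vertex `x` consists of `x` and the six labels `P i j`. -/
lemma nonempty_iso_lambdaGraph (hconn : G.Connected) (hb : G.IsBipartite)
    (hG : IsRectagraph G) (hcard : Fintype.card V = 14) (hreg : G.IsRegularOfDegree 4) :
    Nonempty (G ≃g lambdaGraph) := by
  have c : G.Coloring Bool := hb.toColoring (by simp)
  have hadj : ∀ {u w}, G.Adj u w → c w = !c u := by
    intro u w huw
    have := c.valid huw
    cases h1 : c u <;> cases h2 : c w <;> simp_all
  obtain ⟨x⟩ := hconn.nonempty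
  obtain ⟨a, P, F⟩ := hG.exists_frame x (hreg x)
  set X : Finset V := {w | c w = c x} with hX
  have hXc : #X = 7 := by
    have h := Finset.card_mul_eq_card_mul (s := X) (t := Xᶜ)
      (fun a b => G.Adj a b) (m := 4) (n := 4)
      (fun w hw => by
        rw [← hreg w, ← G.card_neighborFinset_eq_degree]
        congr 1; ext u
        simp only [mem_bipartiteAbove, SimpleGraph.mem_neighborFinset, hX, mem_compl, mem_filter,
          mem_univ, true_and, and_iff_right_iff_imp] at hw ⊢
        intro h; rw [hadj h, hw]; simp)
      (fun w hw => by
        rw [← hreg w, ← G.card_neighborFinset_eq_degree]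
        congr 1; ext u
        simp only [mem_bipartiteBelow, SimpleGraph.mem_neighborFinset, hX, mem_compl, mem_filter,
          mem_univ, true_and] at hw ⊢
        refine ⟨fun h => h.2.symm, fun h => ⟨?_, h.symm⟩⟩
        rw [hadj h]; cases h1 : c w <;> cases h2 : c x <;> simp_all)
    have := card_add_card_compl X
    omega
  have hca : ∀ i, c (a i) = !c x := fun i => hadj (F.adj i)
  have hcP : ∀ {i j}, i ≠ j → c (P i j) = c x := fun h => by
    rw [hadj (F.adj_left h), hca, Bool.not_not]
  have hlist : [x, P 1 2, P 2 3, P 0 3, P 1 3, P 0 2, P 0 1].Nodup := by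
    simp only [List.nodup_cons, List.mem_cons, List.not_mem_nil, not_or, or_false, not_false_eq_true,
      List.nodup_nil, and_true]
    and_intros <;> first
      | exact (F.ne (by decide)).symm
      | exact F.label_ne hG (by decide) (by decide) (by decide)
  -- the half of `x` is exhausted by the labels
  have hhalf : ∀ w, c w = c x → w ≠ x → ∃ i j, i ≠ j ∧ w = P i j := by
    have hsub : [x, P 1 2, P 2 3, P 0 3, P 1 3, P 0 2, P 0 1].toFinset ⊆ X := by
      intro w hw
      simp only [List.mem_toFinset, List.mem_cons, List.not_mem_nil, or_false] at hw
      simp only [hX, mem_filter, mem_univ, true_and]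
      rcases hw with rfl | rfl | rfl | rfl | rfl | rfl | rfl
      · rfl
      all_goals exact hcP (by decide)
    have heq := eq_of_subset_of_card_le hsub (by rw [hXc, List.toFinset_card_of_nodup hlist]; rfl)
    intro w hw hwx
    have : w ∈ X := by simp [hX, hw]
    rw [← heq] at this
    simp only [List.mem_toFinset, List.mem_cons, List.not_mem_nil, or_false] at this
    rcases this with h | h | h | h | h | h | h
    · exact absurd h hwx
    exacts [⟨1, 2, by decide, h⟩, ⟨2, 3, by decide, h⟩, ⟨0, 3, by decide, h⟩,
      ⟨1, 3, by decide, h⟩, ⟨0, 2, by decide, h⟩, ⟨0, 1, by decide, h⟩]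
  -- the vertices not adjacent to `x` in the other half correspond to the four-cycles on the labels
  have hcyc : ∀ i j k l : Fin 4, i ≠ j → i ≠ k → i ≠ l → j ≠ k → j ≠ l → k ≠ l →
      (∀ t, t = i ∨ t = j ∨ t = k ∨ t = l) →
      ∃ g, ¬ G.Adj x g ∧ c g ≠ c x ∧ G.Adj (P i j) g ∧ G.Adj (P i k) g ∧ G.Adj (P j l) g ∧
        G.Adj (P k l) g := by
    intro i j k l hij hik hil hjk hjl hkl hall
    obtain ⟨g, hxg, h1, h2, -⟩ := F.exists_corner hG hij hik hjk
    have hcg : c g ≠ c x := by rw [hadj h1.symm, hcP hij]; simp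
    have hji : G.Adj g (P j i) := by rwa [F.symm]
    have hki : G.Adj g (P k i) := by rwa [F.symm]
    -- otherwise `g` would be adjacent to the triangle `ij`, `ik`, `jk` and to no further label
    have hno : ¬ G.Adj g (P j k) := by
      intro h3
      have hkj : G.Adj g (P k j) := by rwa [F.symm]
      have hlt : #({P i j, P i k, P j k} : Finset V) < #(G.neighborFinset g) := by
        rw [G.card_neighborFinset_eq_degree, hreg g]
        exact lt_of_le_of_lt card_le_three (by decide)
      obtain ⟨z, hz, hz'⟩ := exists_mem_notMem_of_card_lt_card hlt
      rw [SimpleGraph.mem_neighborFinset] at hz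
      simp only [mem_insert, mem_singleton, not_or] at hz'
      have hcz : c z = c x := by
        rw [hadj hz]; cases h1 : c g <;> cases h2 : c x <;> simp_all
      have hzx : z ≠ x := by rintro rfl; exact hxg hz.symm
      have key : ∀ s t, s ≠ l → s ≠ t → z = P s t → False := by
        intro s t hsl hst hzs
        rw [hzs] at hz hz'
        by_cases htl : t = l
        · subst htl
          rcases hall s with rfl | rfl | rfl | rfl
          · exact F.not_three hG _ _ _ _ hxg h1 h2 hz hij hik hst hjk hjl hkl
          · exact F.not_three hG _ _ _ _ hxg hji h3 hz hij.symm hjk hst hik hil hkl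
          · exact F.not_three hG _ _ _ _ hxg hki hkj hz hik.symm hjk.symm hst hij hil hjl
          · exact hst rfl
        · have e1 := F.symm j i
          have e2 := F.symm k i
          have e3 := F.symm k j
          rcases hall s with rfl | rfl | rfl | rfl <;> rcases hall t with rfl | rfl | rfl | rfl <;>
            simp_all
      obtain ⟨s, t, hst, hzs⟩ := hhalf z hcz hzx
      by_cases hsl : s = l
      · exact key t s (by rintro rfl; exact hst hsl) hst.symm (by rw [hzs, F.symm])
      · exact key s t hsl hst hzs
    obtain ⟨m, hm1, hm2, hm3, -⟩ := F.exists_next hG hxg hij.symm hji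
    obtain ⟨m', hm1', hm2', hm3', -⟩ := F.exists_next hG hxg hik.symm hki
    refine ⟨g, hxg, hcg, h1.symm, h2.symm, ?_, ?_⟩
    · rcases hall m with rfl | rfl | rfl | rfl
      · exact absurd rfl hm2
      · exact absurd rfl hm1
      · exact absurd hm3 hno
      · exact hm3.symm
    · rcases hall m' with rfl | rfl | rfl | rfl
      · exact absurd rfl hm2'
      · rw [F.symm] at hm3'; exact absurd hm3' hno
      · exact absurd rfl hm1'
      · exact hm3'.symm
  obtain ⟨c₁, hx1, hc1, h11, h12, h13, h14⟩ := hcyc 0 2 3 1 (by decide) (by decide) (by decide)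
    (by decide) (by decide) (by decide) (by decide)
  obtain ⟨c₂, hx2, hc2, h21, h22, h23, h24⟩ := hcyc 0 1 3 2 (by decide) (by decide) (by decide)
    (by decide) (by decide) (by decide) (by decide)
  obtain ⟨c₃, hx3, hc3, h31, h32, h33, h34⟩ := hcyc 0 1 2 3 (by decide) (by decide) (by decide)
    (by decide) (by decide) (by decide) (by decide)
  rw [F.symm] at h13 h14 h24
  have hlab : IsLambdaLabelling G.Adj x a P c₁ c₂ c₃ := by
    refine ⟨F.adj, fun h => (F.adj_left h.ne).symm, fun h => (F.adj_right h.ne).symm, ?_, ?_, ?_⟩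
    · exact ⟨h11, h12, h13, h14⟩
    · exact ⟨h21, h22, h23, h24⟩
    · exact ⟨h31, h32, h33, h34⟩
  have n12 : c₁ ≠ c₂ := by
    rintro rfl
    exact F.not_three hG 0 1 2 3 hx1 h21.symm h11.symm h12.symm
  have n13 : c₁ ≠ c₃ := by
    rintro rfl
    exact F.not_three hG 0 1 2 3 hx1 h31.symm h11.symm h12.symm
  have n23 : c₂ ≠ c₃ := by
    rintro rfl
    exact F.not_three hG 0 1 2 3 hx2 h31.symm h32.symm h22.symm
  have hac : ∀ {i e}, ¬ G.Adj x e → a i ≠ e := fun h h' => h (h' ▸ F.adj _)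
  have hinj : Function.Injective (lambdaLabel x a P c₁ c₂ c₃) := by
    refine lambdaLabel_injective hlist ?_ ?_
    · simp only [List.nodup_cons, List.mem_cons, List.not_mem_nil, not_or, or_false,
        not_false_eq_true, List.nodup_nil, and_true]
      and_intros <;> first
        | exact F.inj.ne (by decide)
        | exact hac (by assumption)
        | exact (hac (by assumption)).symm
        | assumption
        | exact Ne.symm (by assumption)
    · intro p b h
      have h1 : c (lambdaLabel x a P c₁ c₂ c₃ (.inl p)) = c x := by
        fin_cases p
        · rfl
        all_goals exact hcP (by decide)
      have h2 : c (lambdaLabel x a P c₁ c₂ c₃ (.inr b)) ≠ c x := by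
        fin_cases b <;> first
          | exact hc1
          | exact hc2
          | exact hc3
          | exact (hca _).trans_ne (by simp)
      exact h2 (h ▸ h1)
  refine nonempty_iso_of_injective_hom lambdaGraph _ hinj ?_ ?_ hconn
  · rintro (p | b) (q | d) h
    · exact h.elim
    · exact hlab.rel _ _ h
    · exact (hlab.rel _ _ h).symm
    · exact h.elim
  · have : ∀ v, lambdaGraph.degree v = 4 := by decide
    intro v
    rw [hreg, this]

lemma isBipartiteZeroTwoGraph144_lambdaGraph : IsBipartiteZeroTwoGraph144 lambdaGraph where
  bipartite := ⟨SimpleGraph.Coloring.mk (fun v => if v.isLeft then (0 : Fin 2) else 1) (by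
    rintro (p | b) (q | d) h
    · exact h.elim
    · simp
    · simp
    · exact h.elim)⟩
  zeroTwo := {
    connected := by
      have h1 : ∀ p : Fin 7, ∃ b, lambdaGraph.Adj (.inr b) (.inl p) ∧ 
        lambdaGraph.Adj (.inl 0) (.inr b) := by decide
      have h2 : ∀ b : Fin 7, ∃ p, lambdaGraph.Adj (.inl p) (.inr b) := by decide
      have h3 : ∀ p : Fin 7, lambdaGraph.Reachable (.inl 0) (.inl p) := fun p => by
        obtain ⟨b, hb, hb'⟩ := h1 p
        exact hb'.reachable.trans hb.reachable
      rw [SimpleGraph.connected_iff_exists_forall_reachable]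
      refine ⟨.inl 0, ?_⟩
      rintro (p | b)
      · exact h3 p
      · obtain ⟨p, hp⟩ := h2 b
        exact (h3 p).trans hp.reachable
    zero_or_two := by decide }
  card := by decide
  regular := by
    have : ∀ v, lambdaGraph.degree v = 4 := by decide
    exact this

/-- `Λ` is the unique bipartite `(0,2)`-graph with `14` vertices and valency `4`. -/
theorem isBipartiteZeroTwoGraph144_iff :
    IsBipartiteZeroTwoGraph144 G ↔ Nonempty (G ≃g lambdaGraph) := by
  constructor
  · intro h
    refine nonempty_iso_lambdaGraph h.zeroTwo.connected h.bipartite ⟨?_, ?_⟩ h.card h.regular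
    · intro x y z hxy hyz hxz
      obtain ⟨c⟩ := h.bipartite
      have h1 := c.valid hxy
      have h2 := c.valid hyz
      have h3 := c.valid hxz
      omega
    · intro x y z hne hx hy
      refine exists_square_of_card_eq_two hx hy ?_
      have h0 := h.zeroTwo.zero_or_two x y hne
      rw [card_commonNeighbors_eq] at h0
      refine h0.resolve_left fun h0 => ?_
      rw [card_eq_zero, eq_empty_iff_forall_notMem] at h0
      exact h0 z (by simp [hx, hy])
  · rintro ⟨φ⟩
    have h := isBipartiteZeroTwoGraph144_lambdaGraph
    refine ⟨h.bipartite.of_hom φ.toHom, ⟨?_, ?_⟩, ?_, ?_⟩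
    · exact φ.connected_iff.2 h.zeroTwo.connected
    · intro x y hxy
      have h1 := h.zeroTwo.zero_or_two (φ x) (φ y) (φ.injective.ne hxy)
      have h2 : Fintype.card (G.commonNeighbors x y) =
          Fintype.card (lambdaGraph.commonNeighbors (φ x) (φ y)) := by
        refine Fintype.card_congr (φ.toEquiv.subtypeEquiv fun u => ?_)
        simp only [SimpleGraph.mem_commonNeighbors]
        exact and_congr φ.map_adj_iff.symm φ.map_adj_iff.symm
      rwa [h2]
    · rw [← h.card]; exact Fintype.card_congr φ.toEquiv
    · intro x
      rw [← h.regular (φ x)]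
      exact (φ.degree_eq x).symm

/-! ### Valency five: midpoints of a pair of vertices at distance four -/

lemma IsHalfRegular.ne_of_isFar {m : ℕ} (hG : IsHalfRegular G m) {x y : V} (hxy : IsFar G x y) :
    x ≠ y := by
  rintro rfl
  obtain ⟨a, ha⟩ := hG.exists_adj x
  exact (hxy ha ha).1 rfl

lemma IsFar.notMem_secondSphere {x y : V} (hxy : IsFar G x y) : y ∉ secondSphere G x := fun h => by
  obtain ⟨_, a, h1, h2⟩ := mem_secondSphere.1 h
  exact (hxy h1 h2).1 rfl

/-- The exceptional neighbour of a midpoint is unique. -/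
lemma IsHalfRegular.star_unique {m : ℕ} (hG : IsHalfRegular G m) {x y z g h : V}
    (hxy : IsFar G x y) (hx : z ∈ secondSphere G x) (hy : z ∈ secondSphere G y)
    (hg : G.Adj g z) (hgx : ¬ G.Adj x g) (hgy : ¬ G.Adj y g)
    (hh : G.Adj h z) (hhx : ¬ G.Adj x h) (hhy : ¬ G.Adj y h) : g = h := by
  obtain ⟨e, -, -, -, -, -, hall, -⟩ := hG.exists_star hxy hx hy
  rcases hall g hg.symm with h1 | h1 | h1
  · exact absurd h1 hgx
  · exact absurd h1 hgy
  · rcases hall h hh.symm with h2 | h2 | h2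
    · exact absurd h2 hhx
    · exact absurd h2 hhy
    · exact h1.trans h2.symm

namespace IsFrame

variable {x y : V} {a : Fin 5 → V} {P : Fin 5 → Fin 5 → V}

lemma mem_secondSphere {n : ℕ} {a : Fin n → V} {P : Fin n → Fin n → V} (F : IsFrame G x a P)
    {i j : Fin n} (h : i ≠ j) : P i j ∈ secondSphere G x :=
  AmplyRegular.mem_secondSphere.2 ⟨F.ne h, a i, F.adj i, (F.adj_left h).symm⟩

lemma exists_eq_of_mem {n : ℕ} {a : Fin n → V} {P : Fin n → Fin n → V} (hR : IsRectagraph G)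
    (F : IsFrame G x a P) {z : V} (hz : z ∈ secondSphere G x) : ∃ i j, i ≠ j ∧ z = P i j := by
  obtain ⟨hne, b, hb, hzb⟩ := AmplyRegular.mem_secondSphere.1 hz
  obtain ⟨i, rfl⟩ := F.eq_of_adj hb
  obtain ⟨j, hij, h⟩ := F.exists_eq hR hzb.symm hne
  exact ⟨i, j, hij, h⟩

variable (hG : IsHalfRegular G 2) (F : IsFrame G x a P) (hxy : IsFar G x y)

include hG F hxy

/-- If some `P i j` is a midpoint, then at least three are: the two neighbours of `P i j` and `y`
give further common neighbours with `a i`. -/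
lemma three_le_card_mid {i j : Fin 5} (hij : i ≠ j) (h : P i j ∈ secondSphere G y) :
    3 ≤ #{t | i ≠ t ∧ P i t ∈ secondSphere G y} := by
  have hR := hG.isRectagraph
  obtain ⟨hne, b, hyb, hzb⟩ := AmplyRegular.mem_secondSphere.1 h
  obtain ⟨b', hb', hzb', hyb', -⟩ := hR.square hne hzb hyb
  have key : ∀ b, G.Adj y b → G.Adj (P i j) b → ∃ t, i ≠ t ∧ t ≠ j ∧ G.Adj b (P i t) ∧
      P i t ∈ secondSphere G y := by
    intro b hyb hzb
    have hxb : ¬ G.Adj x b := fun h' => (hxy h' hyb).1 rfl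
    obtain ⟨t, h1, h2, h3, -⟩ := F.exists_next hR hxb hij hzb.symm
    refine ⟨t, h1.symm, h2, h3, hG.mem_of_adj hyb h3 ?_⟩
    rintro h'
    exact (hxy (F.adj i) (h' ▸ (F.adj_left h1.symm).symm)).1 rfl
  obtain ⟨t, h1, h2, h3, h4⟩ := key b hyb hzb
  obtain ⟨t', h1', h2', h3', h4'⟩ := key b' hyb' hzb'
  have htt : t ≠ t' := by
    rintro rfl
    -- otherwise `P i j` and `P i t` have the common neighbours `a i`, `b`, `b'`
    obtain ⟨g, -, -, -, hall⟩ := F.exists_corner hR hij h1 h2.symm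
    have hb1 := (hall b hzb.symm h3).resolve_left
      (by rintro rfl; exact (hxy (F.adj i) hyb).1 rfl)
    have hb2 := (hall b' hzb'.symm h3').resolve_left
      (by rintro rfl; exact (hxy (F.adj i) hyb').1 rfl)
    exact hb' (hb2.trans hb1.symm)
  have hsub : ({j, t, t'} : Finset (Fin 5)) ⊆
      ({t | i ≠ t ∧ P i t ∈ secondSphere G y} : Finset (Fin 5)) := by
    intro s hs
    simp only [mem_insert, mem_singleton] at hs
    simp only [mem_filter, mem_univ, true_and]
    rcases hs with rfl | rfl | rfl
    exacts [⟨hij, h⟩, ⟨h1, h4⟩, ⟨h1', h4'⟩]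
  refine le_trans (ge_of_eq ?_) (card_le_card hsub)
  exact card_eq_three.2 ⟨j, t, t', h2.symm, h2'.symm, htt, rfl⟩

/-- By `three_le_card_mid`, if some `P i j` is a midpoint, then at most one of the four vertices
`P i k` is not. -/
lemma missing_unique {i j k l : Fin 5} (hij : i ≠ j) (h : P i j ∈ secondSphere G y)
    (hik : i ≠ k) (hil : i ≠ l) (hk : P i k ∉ secondSphere G y) (hl : P i l ∉ secondSphere G y) :
    k = l := by
  by_contra hkl
  have h3 := F.three_le_card_mid hG hxy hij h
  have hd : Disjoint ({t | i ≠ t ∧ P i t ∈ secondSphere G y} : Finset (Fin 5)) {i, k, l} := by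
    rw [Finset.disjoint_left]
    intro t ht ht'
    simp only [mem_filter, mem_univ, true_and] at ht
    simp only [mem_insert, mem_singleton] at ht'
    rcases ht' with rfl | rfl | rfl
    exacts [ht.1 rfl, hk ht.2, hl ht.2]
  have h4 := card_union_of_disjoint hd
  have h5 := card_le_univ (({t | i ≠ t ∧ P i t ∈ secondSphere G y} : Finset (Fin 5)) ∪ {i, k, l})
  have h6 : #({i, k, l} : Finset (Fin 5)) = 3 := card_eq_three.2 ⟨i, k, l, hik, hil, hkl, rfl⟩
  rw [Fintype.card_fin] at h5
  omega

/-- If there is a midpoint, then there are at least six: at least four neighbours of `x` are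
adjacent to at least three midpoints each, and a midpoint is adjacent to two neighbours of `x`. -/
lemma six_le_card_mid {z : V} (hx : z ∈ secondSphere G x) (hy : z ∈ secondSphere G y) :
    6 ≤ #(secondSphere G x ∩ secondSphere G y) := by
  have hR := hG.isRectagraph
  obtain ⟨i, j, hij, rfl⟩ := F.exists_eq_of_mem hR hx
  set A : Finset (Fin 5) := {s | ∃ t, s ≠ t ∧ P s t ∈ secondSphere G y} with hA
  have hA4 : 4 ≤ #A := by
    have h3 := F.three_le_card_mid hG hxy hij hy
    have hsub : insert i ({t | i ≠ t ∧ P i t ∈ secondSphere G y} : Finset (Fin 5)) ⊆ A := by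
      intro t ht
      simp only [hA, mem_insert, mem_filter, mem_univ, true_and] at ht ⊢
      rcases ht with rfl | ht
      · exact ⟨j, hij, hy⟩
      · exact ⟨i, ht.1.symm, by rw [F.symm]; exact ht.2⟩
    have := card_le_card hsub
    rw [card_insert_of_notMem (by simp)] at this
    omega
  have h := card_mul_le_card_mul (s := A) (t := secondSphere G x ∩ secondSphere G y)
    (fun i z => G.Adj (a i) z) (m := 3) (n := 2)
    (fun s hs => by
      simp only [hA, mem_filter, mem_univ, true_and] at hs
      obtain ⟨t, hst, ht⟩ := hs
      refine (F.three_le_card_mid hG hxy hst ht).trans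
        (card_le_card_of_injOn (P s) ?_ ?_)
      · intro u hu
        simp only [coe_filter, mem_univ, true_and, Set.mem_ofPred_eq] at hu
        simp only [mem_coe, mem_bipartiteAbove, mem_inter]
        exact ⟨⟨F.mem_secondSphere hu.1, hu.2⟩, F.adj_left hu.1⟩
      · intro u hu v hv huv
        simp only [coe_filter, mem_univ, true_and, Set.mem_ofPred_eq] at hu hv
        rcases F.eq_and_eq hR hu.1 hv.1 huv with h | h
        · exact h.2
        · exact absurd h.1 hv.1)
    (fun z hz => by
      rw [← hG.card_inter (mem_inter.1 hz).1]
      refine card_le_card_of_injOn a ?_ F.inj.injOn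
      intro s hs
      simp only [mem_coe, mem_bipartiteBelow] at hs
      simp [hs.2.symm, F.adj])
  omega

/-- Every neighbour of `x` is adjacent to a midpoint: a neighbour of `x` without this property is at
distance four from `y`, and its midpoints with `y` and those of `x` and `y` are too many for the
second sphere of `y`. -/
lemma exists_mid (hdiam : ∀ u v, IsFar G u v → ∃ z, z ∈ secondSphere G u ∧ z ∈ secondSphere G v)
    (i : Fin 5) : ∃ j, i ≠ j ∧ P i j ∈ secondSphere G y := by
  by_contra! hno
  have hR := hG.isRectagraph
  have hay : IsFar G (a i) y := by
    intro u b hu hb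
    by_cases hux : u = x
    · subst hux
      have hub : ¬ G.Adj u b := fun h => (hxy h hb).1 rfl
      refine ⟨?_, hub⟩
      rintro rfl
      exact (hxy (F.adj i) hb).2 (F.adj i).symm
    · obtain ⟨j, hij, rfl⟩ := F.exists_eq hR hu hux
      constructor
      · rintro rfl
        exact (hxy (F.adj i) hb).2 hu
      · intro h
        refine hno j hij (hG.mem_of_adj hb h.symm ?_)
        intro h'
        exact (hxy (F.adj i) (h' ▸ hu.symm)).1 rfl
  obtain ⟨z, hzx, hzy⟩ := hdiam _ _ hxy
  obtain ⟨z', hzx', hzy'⟩ := hdiam _ _ hay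
  have h1 := F.six_le_card_mid hG hxy hzx hzy
  obtain ⟨a', P', F'⟩ := hR.exists_frame (a i) (n := 5) (by
    rw [← G.card_neighborFinset_eq_degree, hG.card_nbr])
  have h2 := F'.six_le_card_mid hG hay hzx' hzy'
  have hd : Disjoint (secondSphere G x ∩ secondSphere G y)
      (secondSphere G (a i) ∩ secondSphere G y) := by
    rw [Finset.disjoint_left]
    intro w hw hw'
    rw [mem_inter] at hw hw'
    have d1 : Disjoint (G.neighborFinset w ∩ G.neighborFinset x)
        (G.neighborFinset w ∩ G.neighborFinset y) := by
      rw [Finset.disjoint_left]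
      intro u hu hu'
      simp only [mem_inter, SimpleGraph.mem_neighborFinset] at hu hu'
      exact (hxy hu.2 hu'.2).1 rfl
    have d2 : Disjoint ((G.neighborFinset w ∩ G.neighborFinset x) ∪
        (G.neighborFinset w ∩ G.neighborFinset y)) (G.neighborFinset w ∩ G.neighborFinset (a i)) := by
      rw [Finset.disjoint_left]
      intro u hu hu'
      simp only [mem_union, mem_inter, SimpleGraph.mem_neighborFinset] at hu hu'
      rcases hu with hu | hu
      · exact hG.triangle (F.adj i) hu'.2 hu.2
      · exact (hay hu'.2 hu.2).1 rfl
    have hsub : ((G.neighborFinset w ∩ G.neighborFinset x) ∪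
        (G.neighborFinset w ∩ G.neighborFinset y)) ∪
        (G.neighborFinset w ∩ G.neighborFinset (a i)) ⊆ G.neighborFinset w :=
      union_subset (union_subset inter_subset_left inter_subset_left) inter_subset_left
    have hle := card_le_card hsub
    rw [card_union_of_disjoint d2, card_union_of_disjoint d1, hG.card_inter hw.1,
      hG.card_inter hw.2, hG.card_inter hw'.1, hG.card_nbr] at hle
    omega
  have h3 := card_union_of_disjoint hd
  have h4 := card_le_card (union_subset (inter_subset_right (s₁ := secondSphere G x)
    (s₂ := secondSphere G y)) (inter_subset_right (s₁ := secondSphere G (a i))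
    (s₂ := secondSphere G y)))
  rw [hG.card_secondSphere] at h4
  omega

/-- It is impossible that exactly one of the vertices `P i j` is not a midpoint. -/
lemma false_of_one_missing {i j : Fin 5} (hij : i ≠ j) (hm : P i j ∉ secondSphere G y)
    (hall : ∀ s t, s ≠ t → ¬ ((s = i ∧ t = j) ∨ (s = j ∧ t = i)) → P s t ∈ secondSphere G y) :
    False := by
  have hR := hG.isRectagraph
  obtain ⟨k, hki, hkj⟩ : ∃ k, k ≠ i ∧ k ≠ j :=
    (by decide : ∀ i j : Fin 5, ∃ k, k ≠ i ∧ k ≠ j) i j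
  have hzx := F.mem_secondSphere hki.symm
  have hzy := hall i k hki.symm (by rintro (h | h); exacts [hkj h.2, hij h.1])
  have hyx : P i j ≠ y := fun h => hxy.notMem_secondSphere (h ▸ F.mem_secondSphere hij)
  have hny : ∀ h, G.Adj h (P i j) → ¬ G.Adj y h := fun h h1 h2 => hm (hG.mem_of_adj h2 h1 hyx)
  obtain ⟨g, hgx, hgj, hgk, -⟩ := F.exists_corner hR hij hki.symm hkj.symm
  have hgy := hny g hgj
  have hgN : ∀ w, G.Adj g w → w ∈ secondSphere G x ∨ w ∈ secondSphere G y := by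
    obtain ⟨e, -, -, -, -, -, h6, h7⟩ := hG.exists_star hxy hzx hzy
    obtain rfl : g = e := by
      rcases h6 g hgk.symm with h | h | h
      exacts [absurd h hgx, absurd h hgy, h]
    exact h7
  obtain ⟨m, hmj, hmi, hgm, -⟩ := F.exists_next hR hgx hij.symm (by rwa [F.symm])
  -- `g` has at least four neighbours in the second sphere of `x`
  have hone : #(secondSphere G x \ secondSphere G y) ≤ 1 := by
    refine (card_le_card (t := {P i j}) fun w hw => ?_).trans (by simp)
    rw [mem_sdiff] at hw
    obtain ⟨s, t, hst, rfl⟩ := F.exists_eq_of_mem hR hw.1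
    rw [mem_singleton]
    by_contra h
    refine hw.2 (hall s t hst ?_)
    rintro (⟨rfl, rfl⟩ | ⟨rfl, rfl⟩)
    · exact h rfl
    · exact h (F.symm _ _)
  rw [card_sdiff_comm (by rw [hG.card_secondSphere, hG.card_secondSphere])] at hone
  have hsub : G.neighborFinset g \ secondSphere G x ⊆ secondSphere G y \ secondSphere G x := by
    intro w hw
    rw [mem_sdiff, SimpleGraph.mem_neighborFinset] at hw
    exact mem_sdiff.2 ⟨(hgN w hw.1).resolve_left hw.2, hw.2⟩
  have hlt : #({P i j, P i k, P j m} : Finset V) < #(G.neighborFinset g ∩ secondSphere G x) := by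
    have h1 := card_sdiff_add_card_inter (G.neighborFinset g) (secondSphere G x)
    rw [hG.card_nbr] at h1
    have h2 := card_le_card hsub
    have h3 : #({P i j, P i k, P j m} : Finset V) ≤ 3 := card_le_three
    omega
  obtain ⟨w, hw, hw'⟩ := exists_mem_notMem_of_card_lt_card hlt
  rw [mem_inter, SimpleGraph.mem_neighborFinset] at hw
  simp only [mem_insert, mem_singleton, not_or] at hw'
  obtain ⟨s, t, hst, rfl⟩ := F.exists_eq_of_mem hR hw.2
  have hs : ∀ s t, s ≠ t → G.Adj g (P s t) → P s t ≠ P i j → P s t ≠ P i k → P s t ≠ P j m →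
      s ≠ i ∧ s ≠ j := by
    intro s t hst hg h1 h2 h3
    constructor
    · rintro rfl
      exact F.not_three hR _ _ _ _ hgx hgj hgk hg hij hki.symm hst hkj.symm
        (by rintro rfl; exact h1 rfl) (by rintro rfl; exact h2 rfl)
    · rintro rfl
      exact F.not_three hR _ _ _ _ hgx (by rwa [F.symm]) hgm hg hij.symm hmj.symm hst hmi.symm
        (by rintro rfl; exact h1 (F.symm _ _)) (by rintro rfl; exact h3 rfl)
  obtain ⟨hsi, hsj⟩ := hs s t hst hw.1 hw'.1 hw'.2.1 hw'.2.2
  obtain ⟨hti, htj⟩ := hs t s hst.symm (by rw [F.symm]; exact hw.1) (by rw [F.symm]; exact hw'.1)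
    (by rw [F.symm]; exact hw'.2.1) (by rw [F.symm]; exact hw'.2.2)
  have hsty := hall s t hst (by rintro (h | h); exacts [hsi h.1, hsj h.1])
  -- the second common neighbour of `P s t` and `P i j` is again the exceptional one of `P s t`
  obtain ⟨h, hhg, h1, h2, -⟩ := hR.square hw'.1 hw.1.symm hgj.symm
  refine hhg (hG.star_unique hxy hw.2 hsty h1.symm ?_ (hny h h2.symm) hw.1 hgx hgy)
  intro hxh
  obtain ⟨l, rfl⟩ := F.eq_of_adj hxh
  have h3 := F.eq_or_eq hR hst h1.symm
  have h4 := F.eq_or_eq hR hij h2.symm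
  rcases h3 with rfl | rfl <;> rcases h4 with h4 | h4
  exacts [hsi h4, hsj h4, hti h4, htj h4]

end IsFrame

/-! ### Valency five with two missing labels: recognition of the product -/

lemma IsHalfRegular.not_six (hG : IsHalfRegular G 2) {g : V} {l : List V} (hl : l.Nodup)
    (hlen : 6 ≤ l.length) (h : ∀ z ∈ l, G.Adj g z) : False := by
  have h1 : l.toFinset ⊆ G.neighborFinset g := fun z hz => by
    simpa using h z (List.mem_toFinset.1 hz)
  have h2 := card_le_card h1
  rw [List.toFinset_card_of_nodup hl, hG.card_nbr] at h2
  omega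

lemma prodLabel_injective {W : Type*} {f₀ g₀ f₁ g₁ : Fin 7 → W}
    (h : (List.ofFn f₀ ++ List.ofFn g₀ ++ (List.ofFn f₁ ++ List.ofFn g₁)).Nodup) :
    Function.Injective (fun p : Fin 2 × (Fin 7 ⊕ Fin 7) =>
      if p.1 = 0 then Sum.elim f₀ g₀ p.2 else Sum.elim f₁ g₁ p.2) := by
  rw [List.nodup_append', List.nodup_append', List.nodup_append'] at h
  obtain ⟨⟨hf, hg, hfg⟩, ⟨hf', hg', hfg'⟩, hd⟩ := h
  have key : ∀ {f g : Fin 7 → W}, (List.ofFn f).Nodup → (List.ofFn g).Nodup →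
      List.Disjoint (List.ofFn f) (List.ofFn g) → Function.Injective (Sum.elim f g) := by
    intro f g h1 h2 h3
    refine (List.nodup_ofFn.1 h1).sumElim (List.nodup_ofFn.1 h2) fun i j hij => ?_
    exact h3 (List.mem_ofFn.2 ⟨i, rfl⟩) (List.mem_ofFn.2 ⟨j, hij.symm⟩)
  have hmem : ∀ {f g : Fin 7 → W} (v : Fin 7 ⊕ Fin 7),
      Sum.elim f g v ∈ List.ofFn f ++ List.ofFn g := by
    rintro f g (v | v)
    · exact List.mem_append_left _ (List.mem_ofFn.2 ⟨v, rfl⟩)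
    · exact List.mem_append_right _ (List.mem_ofFn.2 ⟨v, rfl⟩)
  have hdis : ∀ v w, Sum.elim f₀ g₀ v ≠ Sum.elim f₁ g₁ w := fun v w he =>
    hd (hmem v) (he ▸ hmem w)
  rintro ⟨c, v⟩ ⟨d, w⟩ hvw
  fin_cases c <;> fin_cases d
  · simpa using key hf hg hfg (by simpa using hvw)
  · exact absurd (by simpa using hvw) (hdis v w)
  · exact absurd (by simpa using hvw.symm) (hdis w v)
  · simpa using key hf' hg' hfg' (by simpa using hvw)

/-- Recognition of the product of an edge and `Λ` from two labelled copies of `Λ` whose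
corresponding vertices are adjacent. -/
lemma nonempty_iso_boxProd (hconn : G.Connected) (hdeg : ∀ v, G.degree v = 5)
    {r r' : V} {n n' : Fin 4 → V} {q q' : Fin 4 → Fin 4 → V} {c₁ c₂ c₃ c₁' c₂' c₃' : V}
    (h : IsLambdaLabelling G.Adj r n q c₁ c₂ c₃) (h' : IsLambdaLabelling G.Adj r' n' q' c₁' c₂' c₃')
    (hr : G.Adj r r') (hn : ∀ i, G.Adj (n i) (n' i)) (hq : ∀ i j, i < j → G.Adj (q i j) (q' i j))
    (hc₁ : G.Adj c₁ c₁') (hc₂ : G.Adj c₂ c₂') (hc₃ : G.Adj c₃ c₃')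
    (hnd : [r, q 1 2, q 2 3, q 0 3, q 1 3, q 0 2, q 0 1, n 0, n 1, n 2, c₂, n 3, c₁, c₃,
      r', q' 1 2, q' 2 3, q' 0 3, q' 1 3, q' 0 2, q' 0 1,
      n' 0, n' 1, n' 2, c₂', n' 3, c₁', c₃'].Nodup) :
    Nonempty (G ≃g (SimpleGraph.completeGraph (Fin 2) □ lambdaGraph)) := by
  classical
  set φ : Fin 2 × (Fin 7 ⊕ Fin 7) → V := fun p =>
    if p.1 = 0 then lambdaLabel r n q c₁ c₂ c₃ p.2 else lambdaLabel r' n' q' c₁' c₂' c₃' p.2 with hφ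
  have hinj : Function.Injective φ := prodLabel_injective (by simpa [List.ofFn_succ] using hnd)
  have hlam : ∀ {r : V} {n : Fin 4 → V} {q : Fin 4 → Fin 4 → V} {c₁ c₂ c₃ : V},
      IsLambdaLabelling G.Adj r n q c₁ c₂ c₃ → ∀ v w, lambdaGraph.Adj v w →
      G.Adj (lambdaLabel r n q c₁ c₂ c₃ v) (lambdaLabel r n q c₁ c₂ c₃ w) := by
    rintro r n q c₁ c₂ c₃ h (p | b) (p' | b') hvw
    · exact hvw.elim
    · exact h.rel _ _ hvw
    · exact (h.rel _ _ hvw).symm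
    · exact hvw.elim
  have hmatch : ∀ v, G.Adj (lambdaLabel r n q c₁ c₂ c₃ v) (lambdaLabel r' n' q' c₁' c₂' c₃' v) := by
    have q01 := hq 0 1 (by decide)
    have q02 := hq 0 2 (by decide)
    have q03 := hq 0 3 (by decide)
    have q12 := hq 1 2 (by decide)
    have q13 := hq 1 3 (by decide)
    have q23 := hq 2 3 (by decide)
    have n0 := hn 0
    have n1 := hn 1
    have n2 := hn 2
    have n3 := hn 3
    rintro (v | v) <;> fin_cases v <;> assumption
  refine nonempty_iso_of_injective_hom _ φ hinj ?_ ?_ hconn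
  · rintro ⟨c, v⟩ ⟨d, w⟩ hvw
    rw [SimpleGraph.boxProd_adj] at hvw
    rcases hvw with ⟨hcd, hvw⟩ | ⟨hvw, hcd⟩
    · obtain rfl : v = w := hvw
      have hcd : c ≠ d := hcd
      fin_cases c <;> fin_cases d
      · exact absurd rfl hcd
      · exact hmatch v
      · exact (hmatch v).symm
      · exact absurd rfl hcd
    · obtain rfl : c = d := hcd
      fin_cases c
      · exact hlam h v w hvw
      · exact hlam h' v w hvw
  · rintro ⟨c, v⟩
    have h1 : lambdaGraph.degree v = 4 := isBipartiteZeroTwoGraph144_lambdaGraph.regular v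
    have h2 : (SimpleGraph.completeGraph (Fin 2)).degree c = 1 := by
      rw [SimpleGraph.complete_graph_degree]; rfl
    rw [SimpleGraph.degree_boxProd, h1, h2, hdeg]

lemma IsFar.not_adj_left {x y g : V} (hxy : IsFar G x y) (h : G.Adj y g) : ¬ G.Adj x g :=
  fun h' => (hxy h' h).1 rfl

namespace IsFrame

variable {x y : V} {a : Fin 5 → V} {P : Fin 5 → Fin 5 → V}

lemma corner_unique {n : ℕ} {a : Fin n → V} {P : Fin n → Fin n → V} (hR : IsRectagraph G)
    (F : IsFrame G x a P) {i j k : Fin n} (hij : i ≠ j) (hik : i ≠ k) (hjk : j ≠ k)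
    {g h : V} (hg : ¬ G.Adj x g) (hgj : G.Adj g (P i j)) (hgk : G.Adj g (P i k))
    (hh : ¬ G.Adj x h) (hhj : G.Adj h (P i j)) (hhk : G.Adj h (P i k)) : g = h := by
  obtain ⟨e, -, -, -, hall⟩ := F.exists_corner hR hij hik hjk
  rcases hall g hgj hgk with rfl | rfl
  · exact absurd (F.adj i) hg
  · rcases hall h hhj hhk with rfl | rfl
    · exact absurd (F.adj i) hh
    · rfl

lemma ne_label {n : ℕ} {a : Fin n → V} {P : Fin n → Fin n → V} (F : IsFrame G x a P)
    (hxy : IsFar G x y) {i j : Fin n} (h : i ≠ j) : y ≠ P i j :=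
  fun h' => hxy.notMem_secondSphere (h' ▸ F.mem_secondSphere h)

lemma not_adj_of_notMem {n m : ℕ} {a : Fin n → V} {P : Fin n → Fin n → V} (hG : IsHalfRegular G m)
    (F : IsFrame G x a P) (hxy : IsFar G x y) {i j : Fin n} {g : V} (hij : i ≠ j)
    (h : P i j ∉ secondSphere G y) (hg : G.Adj g (P i j)) : ¬ G.Adj y g :=
  fun h' => h (hG.mem_of_adj h' hg (F.ne_label hxy hij).symm)

lemma star_unique {n m : ℕ} {a : Fin n → V} {P : Fin n → Fin n → V} (hG : IsHalfRegular G m)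
    (F : IsFrame G x a P) (hxy : IsFar G x y) {i j : Fin n} {g h : V} (hij : i ≠ j)
    (hm : P i j ∈ secondSphere G y) (hg : G.Adj g (P i j)) (hgx : ¬ G.Adj x g)
    (hgy : ¬ G.Adj y g) (hh : G.Adj h (P i j)) (hhx : ¬ G.Adj x h) (hhy : ¬ G.Adj y h) : g = h :=
  hG.star_unique hxy (F.mem_secondSphere hij) hm hg hgx hgy hh hhx hhy

variable (hG : IsHalfRegular G 2) (F : IsFrame G x a P) (hxy : IsFar G x y)

include hG F hxy

/-- A common neighbour of `P o i`, `P o j` and `y` is adjacent to `P i j`, if `P i i'` and `P j j'`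
are not midpoints: the only other closed walk on the labels would be the pentagon `o i j' i' j`,
giving six neighbours. -/
lemma adj_of_adj_of_adj {o i i' j j' : Fin 5} (hnd : [o, i, i', j, j'].Nodup)
    (hcov : ∀ t, t = o ∨ t = i ∨ t = i' ∨ t = j ∨ t = j') (hi : P i i' ∉ secondSphere G y)
    (hj : P j j' ∉ secondSphere G y) {g : V} (hyg : G.Adj y g) (h1 : G.Adj g (P o i))
    (h2 : G.Adj g (P o j)) : G.Adj g (P i j) := by
  have hR := hG.isRectagraph
  simp only [List.nodup_cons, List.mem_cons, List.not_mem_nil, not_or, or_false, not_false_eq_true,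
    List.nodup_nil, and_true] at hnd
  have hoi : o ≠ i := hnd.1.1
  have hoi' : o ≠ i' := hnd.1.2.1
  have hoj : o ≠ j := hnd.1.2.2.1
  have hii' : i ≠ i' := hnd.2.1.1
  have hij : i ≠ j := hnd.2.1.2.1
  have hij' : i ≠ j' := hnd.2.1.2.2
  have hi'j : i' ≠ j := hnd.2.2.1.1
  have hi'j' : i' ≠ j' := hnd.2.2.1.2
  have hjj' : j ≠ j' := hnd.2.2.2
  have hgx : ¬ G.Adj x g := fun h => (hxy h hyg).1 rfl
  have hyP : ∀ {s t}, s ≠ t → y ≠ P s t := fun hst h =>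
    hxy.notMem_secondSphere (h ▸ F.mem_secondSphere hst)
  have hng : ∀ {s t}, s ≠ t → P s t ∉ secondSphere G y → ¬ G.Adj g (P s t) := fun hst h h' =>
    h (hG.mem_of_adj hyg h' (hyP hst).symm)
  have hgi := hng hii' hi
  have hgj := hng hjj' hj
  by_contra hno
  obtain ⟨k, hk1, hk2, hk3, -⟩ := F.exists_next hR hgx hoi.symm (by rwa [F.symm])
  rcases hcov k with rfl | rfl | rfl | rfl | rfl
  · exact hk2 rfl
  · exact hk1 rfl
  · exact hgi hk3
  · exact hno hk3
  obtain ⟨m, hm1, hm2, hm3, -⟩ := F.exists_next hR hgx hoj.symm (by rwa [F.symm])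
  rcases hcov m with rfl | rfl | rfl | rfl | rfl
  · exact hm2 rfl
  · rw [F.symm] at hm3; exact hno hm3
  · obtain ⟨n, hn1, hn2, hn3, -⟩ := F.exists_next hR hgx hm1 (by rwa [F.symm])
    rcases hcov n with rfl | rfl | rfl | rfl | rfl
    · exact F.not_three hR _ _ _ _ hgx h1 h2 (by rwa [F.symm]) hoi hoj hoi' hij hii' hi'j.symm
    · rw [F.symm] at hn3; exact hgi hn3
    · exact hn1 rfl
    · exact hn2 rfl
    · have hji' := hi'j.symm
      have hP : ∀ {i j k l : Fin 5}, i ≠ j → k ≠ l → ¬ ((i = k ∧ j = l) ∨ (i = l ∧ j = k)) →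
          P i j ≠ P k l := fun h h' hne => F.label_ne hR h h' hne
      refine hG.not_six (l := [y, P o i, P o j, P i n, P j m, P m n]) ?_ (by simp) (g := g) ?_
      · simp only [List.nodup_cons, List.mem_cons, List.not_mem_nil, not_or, or_false,
          not_false_eq_true, List.nodup_nil, and_true]
        and_intros <;> first
          | exact hyP (by assumption)
          | exact hP (by assumption) (by assumption) (by grind)
      · simp only [List.mem_cons, List.not_mem_nil, or_false]
        rintro z (rfl | rfl | rfl | rfl | rfl | rfl)
        exacts [hyg.symm, h1, h2, hk3, hm3, hn3]
  · exact hm1 rfl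
  · exact hgj hm3

/-- Let `e` be the exceptional neighbour of the midpoint `z`, and `b`, `b'` the common neighbours of
`z` and `y`. A neighbour `u` of `e` in the second sphere of `y`, outside that of `x`, is adjacent
to `b` or to `b'`. -/
lemma adj_or_adj_of_star {z e b b' u : V} (hzx : z ∈ secondSphere G x)
    (hzy : z ∈ secondSphere G y) (hez : G.Adj e z) (hex : ¬ G.Adj x e) (hey : ¬ G.Adj y e)
    (hbb : b ≠ b') (hb : G.Adj y b) (hbz : G.Adj b z) (hb' : G.Adj y b') (hbz' : G.Adj b' z)
    (huy : u ∈ secondSphere G y) (hux : u ∉ secondSphere G x) (heu : G.Adj e u) :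
    G.Adj u b ∨ G.Adj u b' := by
  have hR := hG.isRectagraph
  have huz : u ≠ z := by rintro rfl; exact hux hzx
  have hxu : u ≠ x := by rintro rfl; exact hxy.symm.notMem_secondSphere huy
  obtain ⟨h, hhe, huh, hzh, -⟩ := hR.square huz heu.symm hez.symm
  have hhx : ¬ G.Adj x h := fun hxh => hux (hG.mem_of_adj hxh huh.symm hxu)
  have hhy : G.Adj y h := by
    by_contra hhy
    exact hhe (hG.star_unique hxy hzx hzy hzh.symm hhx hhy hez hex hey)
  obtain ⟨w, -, -, -, hall⟩ := hR.square (AmplyRegular.mem_secondSphere.1 hzy).1 hbz.symm hb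
  have h1 := (hall b' hbz'.symm hb').resolve_left hbb.symm
  rcases hall h hzh hhy with rfl | h2
  · exact Or.inl huh
  · rw [← h1] at h2; exact Or.inr (h2 ▸ huh)

end IsFrame

/-- Of the ten vertices `P i j`, exactly `P 0 1` and `P 2 3` are not in the second sphere of `y`. -/
structure IsTwoMissing (G : SimpleGraph V) [DecidableRel G.Adj] (y : V) (P : Fin 5 → Fin 5 → V) :
    Prop where
  h01 : P 0 1 ∉ secondSphere G y
  h23 : P 2 3 ∉ secondSphere G y
  h02 : P 0 2 ∈ secondSphere G y
  h03 : P 0 3 ∈ secondSphere G y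
  h12 : P 1 2 ∈ secondSphere G y
  h13 : P 1 3 ∈ secondSphere G y
  h04 : P 0 4 ∈ secondSphere G y
  h14 : P 1 4 ∈ secondSphere G y
  h24 : P 2 4 ∈ secondSphere G y
  h34 : P 3 4 ∈ secondSphere G y

/-- Labels for the four vertices at distance three from `x` and `y`: as cycles on the labels of the
neighbours of `x`, they are `e₁ = 0123`, `e₂ = 0132`, `f₁ = 014` and `f₂ = 234`. -/
structure IsStarLabelling (G : SimpleGraph V) (x y : V) (P : Fin 5 → Fin 5 → V)
    (e₁ e₂ f₁ f₂ : V) : Prop where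
  e1x : ¬ G.Adj x e₁
  e2x : ¬ G.Adj x e₂
  f1x : ¬ G.Adj x f₁
  f2x : ¬ G.Adj x f₂
  e1y : ¬ G.Adj y e₁
  e2y : ¬ G.Adj y e₂
  f1y : ¬ G.Adj y f₁
  f2y : ¬ G.Adj y f₂
  e1_01 : G.Adj e₁ (P 0 1)
  e1_03 : G.Adj e₁ (P 0 3)
  e1_12 : G.Adj e₁ (P 1 2)
  e1_23 : G.Adj e₁ (P 2 3)
  e2_01 : G.Adj e₂ (P 0 1)
  e2_02 : G.Adj e₂ (P 0 2)
  e2_13 : G.Adj e₂ (P 1 3)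
  e2_23 : G.Adj e₂ (P 2 3)
  f1_01 : G.Adj f₁ (P 0 1)
  f1_04 : G.Adj f₁ (P 0 4)
  f1_14 : G.Adj f₁ (P 1 4)
  f2_23 : G.Adj f₂ (P 2 3)
  f2_24 : G.Adj f₂ (P 2 4)
  f2_34 : G.Adj f₂ (P 3 4)
  e12 : e₁ ≠ e₂
  ef11 : e₁ ≠ f₁
  ef21 : e₂ ≠ f₁
  f2e1 : e₁ ≠ f₂
  f2e2 : e₂ ≠ f₂
  f12 : f₁ ≠ f₂
  f1_23 : ¬ G.Adj f₁ (P 2 3)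
  f2_01 : ¬ G.Adj f₂ (P 0 1)

/-- Labels for the two vertices of the second sphere of `y` outside that of `x`. -/
structure IsOuterLabelling (G : SimpleGraph V) [DecidableRel G.Adj] (x y : V)
    (e₁ e₂ f₁ f₂ u₁ u₂ : V) : Prop where
  hu1U : u₁ ∈ secondSphere G y ∧ u₁ ∉ secondSphere G x
  hu2U : u₂ ∈ secondSphere G y ∧ u₂ ∉ secondSphere G x
  e1u1 : G.Adj e₁ u₁
  e2u2 : G.Adj e₂ u₂
  f1u1 : G.Adj f₁ u₁
  f1u2 : G.Adj f₁ u₂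
  f2u1 : G.Adj f₂ u₁
  f2u2 : G.Adj f₂ u₂
  u12 : u₁ ≠ u₂

/-- Labels for the neighbours of `y`: as cycles on the labels of the neighbours of `x`, the vertex
`bᵢⱼ` is the triangle `ij4`, and `bc` is the four-cycle `0213`. -/
structure IsInnerLabelling (G : SimpleGraph V) (y : V) (P : Fin 5 → Fin 5 → V)
    (b02 b03 b12 b13 bc : V) : Prop where
  b02y : G.Adj y b02
  b03y : G.Adj y b03
  b12y : G.Adj y b12
  b13y : G.Adj y b13
  bcy : G.Adj y bc
  b02_02 : G.Adj b02 (P 0 2)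
  b02_04 : G.Adj b02 (P 0 4)
  b02_24 : G.Adj b02 (P 2 4)
  b03_03 : G.Adj b03 (P 0 3)
  b03_04 : G.Adj b03 (P 0 4)
  b03_34 : G.Adj b03 (P 3 4)
  b12_12 : G.Adj b12 (P 1 2)
  b12_14 : G.Adj b12 (P 1 4)
  b12_24 : G.Adj b12 (P 2 4)
  b13_13 : G.Adj b13 (P 1 3)
  b13_14 : G.Adj b13 (P 1 4)
  b13_34 : G.Adj b13 (P 3 4)
  bc_02 : G.Adj bc (P 0 2)
  bc_03 : G.Adj bc (P 0 3)
  bc_12 : G.Adj bc (P 1 2)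
  bc_13 : G.Adj bc (P 1 3)
  n02c : b02 ≠ bc
  n03c : b03 ≠ bc
  n12c : b12 ≠ bc
  n13c : b13 ≠ bc
  n0203 : b02 ≠ b03
  n1213 : b12 ≠ b13
  n0212 : b02 ≠ b12
  n0213 : b02 ≠ b13
  n0312 : b03 ≠ b12
  n0313 : b03 ≠ b13

namespace IsFrame

variable {x y : V} {a : Fin 5 → V} {P : Fin 5 → Fin 5 → V}
  (hG : IsHalfRegular G 2) (F : IsFrame G x a P) (hxy : IsFar G x y)

include hG F hxy

/-- The corners at the missing labels are not adjacent to `x` or `y`. At the midpoints among their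
neighbours they are the exceptional neighbours, of which there is only one each. -/
lemma exists_starLabelling (hM : IsTwoMissing G y P) :
    ∃ e₁ e₂ f₁ f₂, IsStarLabelling G x y P e₁ e₂ f₁ f₂ := by
  have hR := hG.isRectagraph
  obtain ⟨h01, h23, h02, h03, h12, h13, h04, h14, h24, h34⟩ := hM
  obtain ⟨e₂, e2x, e2_01, e2_02, -⟩ := F.exists_corner hR (i := 0) (j := 1) (k := 2)
    (by decide) (by decide) (by decide)
  obtain ⟨e₁, e1x, e1_01, e1_03, -⟩ := F.exists_corner hR (i := 0) (j := 1) (k := 3)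
    (by decide) (by decide) (by decide)
  obtain ⟨f₁, f1x, f1_01, f1_04, -⟩ := F.exists_corner hR (i := 0) (j := 1) (k := 4)
    (by decide) (by decide) (by decide)
  obtain ⟨f₂, f2x, f2_23, f2_24, -⟩ := F.exists_corner hR (i := 2) (j := 3) (k := 4)
    (by decide) (by decide) (by decide)
  have e2y := F.not_adj_of_notMem hG hxy (by decide) h01 e2_01
  have e1y := F.not_adj_of_notMem hG hxy (by decide) h01 e1_01
  have f1y := F.not_adj_of_notMem hG hxy (by decide) h01 f1_01
  have f2y := F.not_adj_of_notMem hG hxy (by decide) h23 f2_23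
  have e12 : e₁ ≠ e₂ := by
    rintro rfl
    exact F.not_three hR 0 1 2 3 e1x e1_01 e2_02 e1_03
  have ef11 : e₁ ≠ f₁ := by
    rintro rfl
    exact F.not_three hR 0 1 3 4 e1x e1_01 e1_03 f1_04
  have ef21 : e₂ ≠ f₁ := by
    rintro rfl
    exact F.not_three hR 0 1 2 4 e2x e2_01 e2_02 f1_04
  have e2_23 : G.Adj e₂ (P 2 3) := by
    obtain ⟨g, gx, g1, g2, -⟩ := F.exists_corner hR (i := 2) (j := 3) (k := 0)
      (by decide) (by decide) (by decide)
    rw [F.symm 2 0] at g2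
    obtain rfl := F.star_unique hG hxy (by decide) h02 g2 gx
      (F.not_adj_of_notMem hG hxy (by decide) h23 g1) e2_02 e2x e2y
    exact g1
  have e1_23 : G.Adj e₁ (P 2 3) := by
    obtain ⟨g, gx, g1, g2, -⟩ := F.exists_corner hR (i := 3) (j := 2) (k := 0)
      (by decide) (by decide) (by decide)
    rw [F.symm 3 0] at g2
    rw [F.symm 3 2] at g1
    obtain rfl := F.star_unique hG hxy (by decide) h03 g2 gx
      (F.not_adj_of_notMem hG hxy (by decide) h23 g1) e1_03 e1x e1y
    exact g1
  have hcom : ∀ {g}, G.Adj g (P 0 1) → G.Adj g (P 2 3) → g = e₁ ∨ g = e₂ := by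
    intro g hg hg'
    obtain ⟨w, -, -, -, hall⟩ := hR.square (F.label_ne hR (i := 0) (j := 1) (k := 2) (l := 3)
      (by decide) (by decide) (by decide)) e1_01.symm e1_23.symm
    have h1 := (hall e₂ e2_01.symm e2_23.symm).resolve_left e12.symm
    rw [h1]
    exact hall g hg.symm hg'.symm
  have e1_12 : G.Adj e₁ (P 1 2) := by
    obtain ⟨g, gx, g1, g2, -⟩ := F.exists_corner hR (i := 1) (j := 0) (k := 2)
      (by decide) (by decide) (by decide)
    obtain ⟨h, hx, h1, h2, -⟩ := F.exists_corner hR (i := 2) (j := 3) (k := 1)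
      (by decide) (by decide) (by decide)
    rw [F.symm 1 0] at g1
    rw [F.symm 2 1] at h2
    obtain rfl := F.star_unique hG hxy (by decide) h12 g2 gx
      (F.not_adj_of_notMem hG hxy (by decide) h01 g1) h2 hx
      (F.not_adj_of_notMem hG hxy (by decide) h23 h1)
    rcases hcom g1 h1 with rfl | rfl
    · exact g2
    · exact (F.not_three hR 2 3 0 1 gx h1 (by rwa [F.symm]) (by rwa [F.symm])).elim
  have e2_13 : G.Adj e₂ (P 1 3) := by
    obtain ⟨g, gx, g1, g2, -⟩ := F.exists_corner hR (i := 1) (j := 0) (k := 3)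
      (by decide) (by decide) (by decide)
    obtain ⟨h, hx, h1, h2, -⟩ := F.exists_corner hR (i := 3) (j := 2) (k := 1)
      (by decide) (by decide) (by decide)
    rw [F.symm 1 0] at g1
    rw [F.symm 3 1] at h2
    rw [F.symm 3 2] at h1
    obtain rfl := F.star_unique hG hxy (by decide) h13 g2 gx
      (F.not_adj_of_notMem hG hxy (by decide) h01 g1) h2 hx
      (F.not_adj_of_notMem hG hxy (by decide) h23 h1)
    rcases hcom g1 h1 with rfl | rfl
    · exact (F.not_three hR 3 2 0 1 gx (by rwa [F.symm]) (by rwa [F.symm]) (by rwa [F.symm])).elim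
    · exact g2
  have f1_23 : ¬ G.Adj f₁ (P 2 3) := fun h => by
    rcases hcom f1_01 h with h | h
    exacts [ef11 h.symm, ef21 h.symm]
  have f2e1 : e₁ ≠ f₂ := by
    rintro rfl
    exact F.not_three hR 2 1 3 4 f2x (by rwa [F.symm]) f2_23 f2_24
  have f2e2 : e₂ ≠ f₂ := by
    rintro rfl
    exact F.not_three hR 2 0 3 4 f2x (by rwa [F.symm]) f2_23 f2_24
  have f2_01 : ¬ G.Adj f₂ (P 0 1) := fun h => by
    rcases hcom h f2_23 with h | h
    exacts [f2e1 h.symm, f2e2 h.symm]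
  have f12 : f₁ ≠ f₂ := fun h => f2_01 (h ▸ f1_01)
  have f1_14 : G.Adj f₁ (P 1 4) := by
    obtain ⟨k, hk1, hk2, hk3, -⟩ := F.exists_next hR f1x (i := 1) (j := 0) (by decide)
      (by rwa [F.symm])
    fin_cases k
    · exact absurd rfl hk2
    · exact absurd rfl hk1
    · exact absurd (F.star_unique hG hxy (by decide) h12 e1_12 e1x e1y hk3 f1x f1y) ef11
    · exact absurd (F.star_unique hG hxy (by decide) h13 e2_13 e2x e2y hk3 f1x f1y) ef21
    · exact hk3
  have f2_34 : G.Adj f₂ (P 3 4) := by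
    obtain ⟨k, hk1, hk2, hk3, -⟩ := F.exists_next hR f2x (i := 3) (j := 2) (by decide)
      (by rwa [F.symm])
    fin_cases k
    · exact absurd (F.star_unique hG hxy (by decide) h03 e1_03 e1x e1y
        (by rw [F.symm]; exact hk3) f2x f2y) f2e1
    · exact absurd (F.star_unique hG hxy (by decide) h13 e2_13 e2x e2y
        (by rw [F.symm]; exact hk3) f2x f2y) f2e2
    · exact absurd rfl hk2
    · exact absurd rfl hk1
    · exact hk3
  exact ⟨e₁, e₂, f₁, f₂, e1x, e2x, f1x, f2x, e1y, e2y, f1y, f2y, e1_01, e1_03, e1_12, e1_23,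
    e2_01, e2_02, e2_13, e2_23, f1_01, f1_04, f1_14, f2_23, f2_24, f2_34, e12, ef11, ef21, f2e1,
    f2e2, f12, f1_23, f2_01⟩

/-- The vertices `f₁`, `f₂` have three neighbours in the second sphere of `x`, and `e₁`, `e₂` have
four; the remaining ones are in the second sphere of `y`. -/
lemma exists_outerLabelling (hM : IsTwoMissing G y P) {e₁ e₂ f₁ f₂ : V}
    (hS : IsStarLabelling G x y P e₁ e₂ f₁ f₂) :
    ∃ u₁ u₂, IsOuterLabelling G x y e₁ e₂ f₁ f₂ u₁ u₂ := by
  have hR := hG.isRectagraph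
  obtain ⟨h01, h23, h02, h03, h12, h13, h04, h14, h24, h34⟩ := hM
  obtain ⟨e1x, e2x, f1x, f2x, e1y, e2y, f1y, f2y, e1_01, e1_03, e1_12, e1_23, e2_01, e2_02, e2_13,
    e2_23, f1_01, f1_04, f1_14, f2_23, f2_24, f2_34, e12, ef11, ef21, f2e1, f2e2, f12, f1_23,
    f2_01⟩ := hS
  -- the two vertices of the second sphere of `y` outside that of `x`
  have hU : #(secondSphere G y \ secondSphere G x) ≤ 2 := by
    rw [card_sdiff_comm (by rw [hG.card_secondSphere, hG.card_secondSphere])]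
    refine (card_le_card (t := {P 0 1, P 2 3}) fun w hw => ?_).trans card_le_two
    rw [mem_sdiff] at hw
    obtain ⟨s, t, hst, rfl⟩ := F.exists_eq_of_mem hR hw.1
    have key : ∀ s t : Fin 5, s < t → P s t ∉ secondSphere G y →
        P s t ∈ ({P 0 1, P 2 3} : Finset V) := by
      intro s t hst hn
      fin_cases s <;> fin_cases t <;> first
        | exact absurd hst (by decide)
        | exact absurd (by assumption) hn
        | simp
    rcases lt_or_gt_of_ne hst with h | h
    · exact key s t h hw.2
    · rw [F.symm s t] at hw ⊢
      exact key t s h hw.2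
  have hstarN : ∀ {g s t}, s ≠ t → P s t ∈ secondSphere G y → G.Adj g (P s t) → ¬ G.Adj x g →
      ¬ G.Adj y g → G.neighborFinset g \ secondSphere G x ⊆
        secondSphere G y \ secondSphere G x := by
    intro g s t hst hm hg gx gy w hw
    rw [mem_sdiff, SimpleGraph.mem_neighborFinset] at hw
    obtain ⟨e, -, -, -, -, -, h6, h7⟩ := hG.exists_star hxy (F.mem_secondSphere hst) hm
    obtain rfl : g = e := by
      rcases h6 g hg.symm with h | h | h
      exacts [absurd h gx, absurd h gy, h]
    exact mem_sdiff.2 ⟨(h7 w hw.1).resolve_left hw.2, hw.2⟩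
  have hcount : ∀ {g} (S : Finset V), G.neighborFinset g ∩ secondSphere G x ⊆ S →
      5 ≤ #(G.neighborFinset g \ secondSphere G x) + #S := by
    intro g S hS
    have h1 := card_sdiff_add_card_inter (G.neighborFinset g) (secondSphere G x)
    rw [hG.card_nbr] at h1
    have := card_le_card hS
    omega
  have hsubS : ∀ {g} (S : Finset V), (∀ s t, s < t → G.Adj g (P s t) → P s t ∈ S) →
      G.neighborFinset g ∩ secondSphere G x ⊆ S := by
    intro g S h w hw
    rw [mem_inter, SimpleGraph.mem_neighborFinset] at hw
    obtain ⟨s, t, hst, rfl⟩ := F.exists_eq_of_mem hR hw.2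
    rcases lt_or_gt_of_ne hst with h' | h'
    · exact h s t h' hw.1
    · rw [F.symm s t] at hw ⊢; exact h t s h' hw.1
  have sat : ∀ {g} (i j k l : Fin 5), ¬ G.Adj x g → G.Adj g (P i j) → G.Adj g (P i k) →
      i ≠ j → i ≠ k → j ≠ k → i ≠ l → G.Adj g (P i l) → l = j ∨ l = k := by
    intro g i j k l hg h1 h2 n1 n2 n3 n4 h3
    by_contra! h
    exact F.not_three hR i j k l hg h1 h2 h3 n1 n2 n4 n3 h.1.symm h.2.symm
  have hf1U : G.neighborFinset f₁ \ secondSphere G x = secondSphere G y \ secondSphere G x := by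
    refine eq_of_subset_of_card_le (hstarN (by decide) h04 f1_04 f1x f1y) (hU.trans ?_)
    have h1 := hcount (g := f₁) {P 0 1, P 0 4, P 1 4} (hsubS _ ?_)
    · have h2 : #({P 0 1, P 0 4, P 1 4} : Finset V) ≤ 3 := card_le_three
      omega
    · intro s t hst h
      have h0 := fun l => sat 0 1 4 l f1x f1_01 f1_04 (by decide) (by decide) (by decide)
      have h1 := fun l => sat 1 0 4 l f1x (by rwa [F.symm]) f1_14 (by decide) (by decide)
        (by decide)
      have h4 := fun l => sat 4 0 1 l f1x (by rwa [F.symm]) (by rwa [F.symm]) (by decide)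
        (by decide) (by decide)
      fin_cases s <;> fin_cases t <;> first
        | exact absurd hst (by decide)
        | simp; done
        | exact absurd h f1_23
        | exact absurd (h0 _ (by decide) h) (by decide)
        | exact absurd (h1 _ (by decide) h) (by decide)
        | exact absurd (h4 _ (by decide) ((F.symm _ _).symm ▸ h)) (by decide)
  have hf2U : G.neighborFinset f₂ \ secondSphere G x = secondSphere G y \ secondSphere G x := by
    refine eq_of_subset_of_card_le (hstarN (by decide) h24 f2_24 f2x f2y) (hU.trans ?_)
    have h1 := hcount (g := f₂) {P 2 3, P 2 4, P 3 4} (hsubS _ ?_)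
    · have h2 : #({P 2 3, P 2 4, P 3 4} : Finset V) ≤ 3 := card_le_three
      omega
    · intro s t hst h
      have h2 := fun l => sat 2 3 4 l f2x f2_23 f2_24 (by decide) (by decide) (by decide)
      have h3 := fun l => sat 3 2 4 l f2x (by rwa [F.symm]) f2_34 (by decide) (by decide)
        (by decide)
      have h4 := fun l => sat 4 2 3 l f2x (by rwa [F.symm]) (by rwa [F.symm]) (by decide)
        (by decide) (by decide)
      fin_cases s <;> fin_cases t <;> first
        | exact absurd hst (by decide)
        | simp; done
        | exact absurd h f2_01
        | exact absurd (h2 _ (by decide) ((F.symm _ _).symm ▸ h)) (by decide)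
        | exact absurd (h3 _ (by decide) ((F.symm _ _).symm ▸ h)) (by decide)
        | exact absurd (h4 _ (by decide) ((F.symm _ _).symm ▸ h)) (by decide)
  obtain ⟨u₁, hu1⟩ : (G.neighborFinset e₁ \ secondSphere G x).Nonempty := by
    have h1 := hcount (g := e₁) {P 0 1, P 0 3, P 1 2, P 2 3} (hsubS _ ?_)
    · have h2 : #({P 0 1, P 0 3, P 1 2, P 2 3} : Finset V) ≤ 4 := card_le_four
      exact card_pos.1 (by omega)
    · intro s t hst h
      have h0 := fun l => sat 0 1 3 l e1x e1_01 e1_03 (by decide) (by decide) (by decide)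
      have h1 := fun l => sat 1 0 2 l e1x (by rwa [F.symm]) e1_12 (by decide) (by decide)
        (by decide)
      have h2 := fun l => sat 2 1 3 l e1x (by rwa [F.symm]) e1_23 (by decide) (by decide)
        (by decide)
      have h3 := fun l => sat 3 0 2 l e1x (by rwa [F.symm]) (by rwa [F.symm]) (by decide)
        (by decide) (by decide)
      fin_cases s <;> fin_cases t <;> first
        | exact absurd hst (by decide)
        | simp; done
        | exact absurd (h0 _ (by decide) h) (by decide)
        | exact absurd (h1 _ (by decide) h) (by decide)
        | exact absurd (h2 _ (by decide) h) (by decide)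
        | exact absurd (h3 _ (by decide) h) (by decide)
  obtain ⟨u₂, hu2⟩ : (G.neighborFinset e₂ \ secondSphere G x).Nonempty := by
    have h1 := hcount (g := e₂) {P 0 1, P 0 2, P 1 3, P 2 3} (hsubS _ ?_)
    · have h2 : #({P 0 1, P 0 2, P 1 3, P 2 3} : Finset V) ≤ 4 := card_le_four
      exact card_pos.1 (by omega)
    · intro s t hst h
      have h0 := fun l => sat 0 1 2 l e2x e2_01 e2_02 (by decide) (by decide) (by decide)
      have h1 := fun l => sat 1 0 3 l e2x (by rwa [F.symm]) e2_13 (by decide) (by decide)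
        (by decide)
      have h2 := fun l => sat 2 0 3 l e2x (by rwa [F.symm]) e2_23 (by decide) (by decide)
        (by decide)
      have h3 := fun l => sat 3 1 2 l e2x (by rwa [F.symm]) (by rwa [F.symm]) (by decide)
        (by decide) (by decide)
      fin_cases s <;> fin_cases t <;> first
        | exact absurd hst (by decide)
        | simp; done
        | exact absurd (h0 _ (by decide) h) (by decide)
        | exact absurd (h1 _ (by decide) h) (by decide)
        | exact absurd (h2 _ (by decide) h) (by decide)
        | exact absurd (h3 _ (by decide) h) (by decide)
  have hu1U := hstarN (by decide) h03 e1_03 e1x e1y hu1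
  have hu2U := hstarN (by decide) h02 e2_02 e2x e2y hu2
  have f1u1 : G.Adj f₁ u₁ := by
    have := hu1U; rw [← hf1U] at this; simpa using (mem_sdiff.1 this).1
  have f1u2 : G.Adj f₁ u₂ := by
    have := hu2U; rw [← hf1U] at this; simpa using (mem_sdiff.1 this).1
  have f2u1 : G.Adj f₂ u₁ := by
    have := hu1U; rw [← hf2U] at this; simpa using (mem_sdiff.1 this).1
  have f2u2 : G.Adj f₂ u₂ := by
    have := hu2U; rw [← hf2U] at this; simpa using (mem_sdiff.1 this).1
  rw [mem_sdiff] at hu1U hu2U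
  have e1u1 : G.Adj e₁ u₁ := by simpa using (mem_sdiff.1 hu1).1
  have e2u2 : G.Adj e₂ u₂ := by simpa using (mem_sdiff.1 hu2).1
  have u12 : u₁ ≠ u₂ := by
    rintro rfl
    obtain ⟨w, -, -, -, hall⟩ := hR.square e12 e1_01 e2_01
    have h1 := (hall _ e1_23 e2_23).resolve_left (F.label_ne hR (by decide) (by decide) (by decide))
    rcases hall _ e1u1 e2u2 with h2 | h2
    · exact hu1U.2 (h2 ▸ F.mem_secondSphere (by decide))
    · exact hu1U.2 ((h2.trans h1.symm) ▸ F.mem_secondSphere (by decide))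
  exact ⟨u₁, u₂, hu1U, hu2U, e1u1, e2u2, f1u1, f1u2, f2u1, f2u2, u12⟩

lemma exists_innerLabelling (hM : IsTwoMissing G y P) {e₁ e₂ f₁ f₂ : V}
    (hS : IsStarLabelling G x y P e₁ e₂ f₁ f₂) :
    ∃ b02 b03 b12 b13 bc, IsInnerLabelling G y P b02 b03 b12 b13 bc := by
  have hR := hG.isRectagraph
  obtain ⟨h01, h23, h02, h03, h12, h13, h04, h14, h24, h34⟩ := hM
  obtain ⟨e1x, e2x, f1x, f2x, e1y, e2y, f1y, f2y, e1_01, e1_03, e1_12, e1_23, e2_01, e2_02, e2_13,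
    e2_23, f1_01, f1_04, f1_14, f2_23, f2_24, f2_34, e12, ef11, ef21, f2e1, f2e2, f12, f1_23,
    f2_01⟩ := hS
  have hb : ∀ i i' j j' : Fin 5, [4, i, i', j, j'].Nodup →
      (∀ t, t = 4 ∨ t = i ∨ t = i' ∨ t = j ∨ t = j') → P i i' ∉ secondSphere G y →
      P j j' ∉ secondSphere G y → P i 4 ∈ secondSphere G y → P j 4 ∈ secondSphere G y →
      G.Adj f₁ (P i 4) → G.Adj f₂ (P j 4) →
      ∃ b, G.Adj y b ∧ G.Adj b (P i 4) ∧ G.Adj b (P j 4) ∧ G.Adj b (P i j) := by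
    intro i i' j j' hnd hcov hi hj hi4 hj4 hf1 hf2
    have hnd' := hnd
    simp only [List.nodup_cons, List.mem_cons, List.not_mem_nil, not_or, or_false] at hnd'
    obtain ⟨⟨n1, n2, n3, n4⟩, ⟨n5, n6, n7⟩, -⟩ := hnd'
    obtain ⟨g, gx, g1, g2, -⟩ := F.exists_corner hR n1 n3 n6
    have hyg : G.Adj y g := by
      by_contra gy
      rw [F.symm] at g1 g2
      have h1 := F.star_unique hG hxy (Ne.symm n1) hi4 g1 gx gy hf1 f1x f1y
      have h2 := F.star_unique hG hxy (Ne.symm n3) hj4 g2 gx gy hf2 f2x f2y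
      exact f12 (h1.symm.trans h2)
    refine ⟨g, hyg, by rwa [F.symm], by rwa [F.symm], ?_⟩
    exact F.adj_of_adj_of_adj hG hxy hnd hcov hi hj hyg g1 g2
  have h10 : P 1 0 ∉ secondSphere G y := by rwa [F.symm]
  have h32 : P 3 2 ∉ secondSphere G y := by rwa [F.symm]
  obtain ⟨b02, b02y, b02_04, b02_24, b02_02⟩ := hb 0 1 2 3 (by decide) (by decide) h01 h23 h04 h24
    f1_04 f2_24
  obtain ⟨b03, b03y, b03_04, b03_34, b03_03⟩ := hb 0 1 3 2 (by decide) (by decide) h01 h32 h04 h34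
    f1_04 f2_34
  obtain ⟨b12, b12y, b12_14, b12_24, b12_12⟩ := hb 1 0 2 3 (by decide) (by decide) h10 h23 h14 h24
    f1_14 f2_24
  obtain ⟨b13, b13y, b13_14, b13_34, b13_13⟩ := hb 1 0 3 2 (by decide) (by decide) h10 h32 h14 h34
    f1_14 f2_34
  obtain ⟨bc, bcx, bc_02, bc_03, -⟩ := F.exists_corner hR (i := 0) (j := 2) (k := 3)
    (by decide) (by decide) (by decide)
  have bcy : G.Adj y bc := by
    by_contra h
    have h1 := F.star_unique hG hxy (by decide) h02 bc_02 bcx h e2_02 e2x e2y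
    have h2 := F.star_unique hG hxy (by decide) h03 bc_03 bcx h e1_03 e1x e1y
    exact e12 (h2.symm.trans h1)
  have n02c : b02 ≠ bc := by
    rintro rfl
    exact F.not_three hR 0 2 3 4 bcx bc_02 bc_03 b02_04
  have n03c : b03 ≠ bc := by
    rintro rfl
    exact F.not_three hR 0 2 3 4 bcx bc_02 bc_03 b03_04
  have bc_12 : G.Adj bc (P 1 2) := by
    obtain ⟨k, hk1, hk2, hk3, -⟩ := F.exists_next hR bcx (i := 2) (j := 0) (by decide)
      (by rwa [F.symm])
    fin_cases k
    · exact absurd rfl hk2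
    · rw [F.symm]; exact hk3
    · exact absurd rfl hk1
    · exact absurd bcy (F.not_adj_of_notMem hG hxy (by decide) h23 hk3)
    · exact absurd (F.corner_unique hR (i := 2) (j := 0) (k := 4) (by decide) (by decide)
        (by decide) (hxy.not_adj_left b02y) (by rwa [F.symm]) b02_24 bcx (by rwa [F.symm]) hk3) n02c
  have bc_13 : G.Adj bc (P 1 3) := by
    obtain ⟨k, hk1, hk2, hk3, -⟩ := F.exists_next hR bcx (i := 3) (j := 0) (by decide)
      (by rwa [F.symm])
    fin_cases k
    · exact absurd rfl hk2
    · rw [F.symm]; exact hk3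
    · exact absurd bcy (F.not_adj_of_notMem hG hxy (by decide) h32 hk3)
    · exact absurd rfl hk1
    · exact absurd (F.corner_unique hR (i := 3) (j := 0) (k := 4) (by decide) (by decide)
        (by decide) (hxy.not_adj_left b03y) (by rwa [F.symm]) b03_34 bcx (by rwa [F.symm]) hk3) n03c
  have n12c : b12 ≠ bc := by
    rintro rfl
    exact F.not_three hR 1 2 3 4 bcx bc_12 bc_13 b12_14
  have n13c : b13 ≠ bc := by
    rintro rfl
    exact F.not_three hR 1 2 3 4 bcx bc_12 bc_13 b13_14
  have n0203 : b02 ≠ b03 := by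
    rintro rfl
    exact F.not_three hR 0 2 3 4 (hxy.not_adj_left b02y) b02_02 b03_03 b02_04
  have n1213 : b12 ≠ b13 := by
    rintro rfl
    exact F.not_three hR 1 2 3 4 (hxy.not_adj_left b12y) b12_12 b13_13 b12_14
  have n0212 : b02 ≠ b12 := by
    rintro rfl
    exact F.not_three_right hR 4 0 1 2 (hxy.not_adj_left b02y) b02_04 b12_14 b02_24
  have n0213 : b02 ≠ b13 := by
    rintro rfl
    exact F.not_three_right hR 4 0 1 2 (hxy.not_adj_left b02y) b02_04 b13_14 b02_24
  have n0312 : b03 ≠ b12 := by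
    rintro rfl
    exact F.not_three_right hR 4 0 1 2 (hxy.not_adj_left b03y) b03_04 b12_14 b12_24
  have n0313 : b03 ≠ b13 := by
    rintro rfl
    exact F.not_three_right hR 4 0 1 3 (hxy.not_adj_left b03y) b03_04 b13_14 b03_34
  exact ⟨b02, b03, b12, b13, bc, b02y, b03y, b12y, b13y, bcy, b02_02, b02_04, b02_24, b03_03,
    b03_04, b03_34, b12_12, b12_14, b12_24, b13_13, b13_14, b13_34, bc_02, bc_03, bc_12, bc_13,
    n02c, n03c, n12c, n13c, n0203,
    n1213, n0212, n0213, n0312, n0313⟩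

/-- The vertex `bc` is adjacent to `y` and four labels, so it has no neighbour in the second sphere of
`y` outside that of `x`; the other common neighbour of a label and `y` is then adjacent to such a
vertex. -/
lemma adj_outer_inner (hM : IsTwoMissing G y P) {e₁ e₂ f₁ f₂ u₁ u₂ b02 b03 b12 b13 bc : V}
    (hS : IsStarLabelling G x y P e₁ e₂ f₁ f₂) (hU : IsOuterLabelling G x y e₁ e₂ f₁ f₂ u₁ u₂)
    (hB : IsInnerLabelling G y P b02 b03 b12 b13 bc) :
    G.Adj u₁ b12 ∧ G.Adj u₁ b03 ∧ G.Adj u₂ b02 ∧ G.Adj u₂ b13 := by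
  have hR := hG.isRectagraph
  obtain ⟨h01, h23, h02, h03, h12, h13, h04, h14, h24, h34⟩ := hM
  obtain ⟨e1x, e2x, f1x, f2x, e1y, e2y, f1y, f2y, e1_01, e1_03, e1_12, e1_23, e2_01, e2_02, e2_13,
    e2_23, f1_01, f1_04, f1_14, f2_23, f2_24, f2_34, e12, ef11, ef21, f2e1, f2e2, f12, f1_23,
    f2_01⟩ := hS
  obtain ⟨hu1U, hu2U, e1u1, e2u2, f1u1, f1u2, f2u1, f2u2, u12⟩ := hU
  obtain ⟨b02y, b03y, b12y, b13y, bcy, b02_02, b02_04, b02_24, b03_03, b03_04, b03_34, b12_12,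
    b12_14, b12_24, b13_13, b13_14, b13_34, bc_02, bc_03, bc_12, bc_13, n02c, n03c, n12c, n13c,
    n0203, n1213, n0212, n0213, n0312, n0313⟩ := hB
  have hbcu : ∀ {u}, u ∉ secondSphere G x → u ∈ secondSphere G y → ¬ G.Adj u bc := by
    intro u hux huy h
    have huP : ∀ {s t}, s ≠ t → u ≠ P s t := fun hst h => hux (h ▸ F.mem_secondSphere hst)
    refine hG.not_six (g := bc) (l := [u, y, P 0 2, P 0 3, P 1 2, P 1 3]) ?_ (by simp) ?_
    · simp only [List.nodup_cons, List.mem_cons, List.not_mem_nil, not_or, or_false,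
        not_false_eq_true, List.nodup_nil, and_true]
      and_intros <;> first
        | exact (AmplyRegular.mem_secondSphere.1 huy).1
        | exact F.ne_label hxy (by decide)
        | exact huP (by decide)
        | exact F.label_ne hR (by decide) (by decide) (by decide)
    · simp only [List.mem_cons, List.not_mem_nil, or_false]
      rintro z (rfl | rfl | rfl | rfl | rfl | rfl)
      exacts [h.symm, bcy.symm, bc_02, bc_03, bc_12, bc_13]
  have hub : ∀ {e b u} (s t : Fin 5), s ≠ t → P s t ∈ secondSphere G y → G.Adj e (P s t) →
      ¬ G.Adj x e → ¬ G.Adj y e → b ≠ bc → G.Adj y b → G.Adj b (P s t) → G.Adj bc (P s t) →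
      u ∈ secondSphere G y ∧ u ∉ secondSphere G x → G.Adj e u → G.Adj u b := by
    intro e b u s t hst hm he hex hey hbb hyb hbP hcP hu heu
    exact (F.adj_or_adj_of_star hG hxy (F.mem_secondSphere hst) hm he hex hey hbb hyb hbP bcy hcP
      hu.1 hu.2 heu).resolve_right (hbcu hu.2 hu.1)
  have u1_12 := hub 1 2 (by decide) h12 e1_12 e1x e1y n12c b12y b12_12 bc_12 hu1U e1u1
  have u1_03 := hub 0 3 (by decide) h03 e1_03 e1x e1y n03c b03y b03_03 bc_03 hu1U e1u1
  have u2_02 := hub 0 2 (by decide) h02 e2_02 e2x e2y n02c b02y b02_02 bc_02 hu2U e2u2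
  have u2_13 := hub 1 3 (by decide) h13 e2_13 e2x e2y n13c b13y b13_13 bc_13 hu2U e2u2
  exact ⟨u1_12, u1_03, u2_02, u2_13⟩

/-- If the vertices `P i j` that are not midpoints are `P 0 1` and `P 2 3`, then the whole graph is
determined: it is the product of an edge and `Λ`, with `x` and `a 4` as the roots of the two
copies of `Λ`. -/
lemma nonempty_iso_of_two_missing (hconn : G.Connected) (hM : IsTwoMissing G y P) :
    Nonempty (G ≃g (SimpleGraph.completeGraph (Fin 2) □ lambdaGraph)) := by
  obtain ⟨e₁, e₂, f₁, f₂, hS⟩ := F.exists_starLabelling hG hxy hM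
  obtain ⟨u₁, u₂, hU⟩ := F.exists_outerLabelling hG hxy hM hS
  obtain ⟨b02, b03, b12, b13, bc, hB⟩ := F.exists_innerLabelling hG hxy hM hS
  obtain ⟨u1_12, u1_03, u2_02, u2_13⟩ := F.adj_outer_inner hG hxy hM hS hU hB
  have hR := hG.isRectagraph
  obtain ⟨h01, h23, h02, h03, h12, h13, h04, h14, h24, h34⟩ := hM
  obtain ⟨e1x, e2x, f1x, f2x, e1y, e2y, f1y, f2y, e1_01, e1_03, e1_12, e1_23, e2_01, e2_02, e2_13,
    e2_23, f1_01, f1_04, f1_14, f2_23, f2_24, f2_34, e12, ef11, ef21, f2e1, f2e2, f12, f1_23,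
    f2_01⟩ := hS
  obtain ⟨hu1U, hu2U, e1u1, e2u2, f1u1, f1u2, f2u1, f2u2, u12⟩ := hU
  obtain ⟨b02y, b03y, b12y, b13y, bcy, b02_02, b02_04, b02_24, b03_03, b03_04, b03_34, b12_12,
    b12_14, b12_24, b13_13, b13_14, b13_34, bc_02, bc_03, bc_12, bc_13, n02c, n03c, n12c, n13c,
    n0203, n1213, n0212, n0213, n0312, n0313⟩ := hB
  -- all labels are distinct: those in different distance layers around `x` and `y` clearly are
  have hyPadj : ∀ {s t}, s ≠ t → ¬ G.Adj y (P s t) := fun hst h =>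
    (hxy (F.adj _) h).2 (F.adj_left hst)
  have hstarS : ∀ {g s t}, s ≠ t → P s t ∈ secondSphere G y → G.Adj g (P s t) → ¬ G.Adj x g →
      ¬ G.Adj y g → g ∉ secondSphere G x ∧ g ∉ secondSphere G y := by
    intro g s t hst hm hg gx gy
    obtain ⟨e, -, -, -, h4, h5, h6, -⟩ := hG.exists_star hxy (F.mem_secondSphere hst) hm
    obtain rfl : g = e := by
      rcases h6 g hg.symm with h | h | h
      exacts [absurd h gx, absurd h gy, h]
    exact ⟨h4, h5⟩
  -- `ℓ` numbers the layers
  set ℓ : V → ℕ := fun w => if w = x then 0 else if G.Adj x w then 1 else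
    if w ∈ secondSphere G x then 2 else if G.Adj y w then 3 else
    if w ∈ secondSphere G y then 4 else if w = y then 5 else 6 with hℓ
  have hne := hG.ne_of_isFar hxy
  have hnadj : ¬ G.Adj x y := fun h => by
    obtain ⟨b, hb⟩ := hG.exists_adj x
    exact (hxy hb h.symm).2 hb.symm
  have ℓx : ℓ x = 0 := by simp [hℓ]
  have ℓa : ∀ i, ℓ (a i) = 1 := fun i => by simp [hℓ, F.adj i, (F.adj i).ne']
  have ℓP : ∀ {s t}, s ≠ t → ℓ (P s t) = 2 := fun {s t} h => by
    simp [hℓ, F.ne h, hG.not_adj_of_mem (F.mem_secondSphere h), F.mem_secondSphere h]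
  have ℓb : ∀ {b}, G.Adj y b → ℓ b = 3 := fun {b} h => by
    have h1 : b ≠ x := by rintro rfl; exact hnadj h.symm
    have h2 : b ∉ secondSphere G x := fun h' => by
      obtain ⟨_, c, hc, hbc⟩ := AmplyRegular.mem_secondSphere.1 h'
      exact (hxy hc h).2 hbc.symm
    simp [hℓ, h1, hxy.not_adj_left h, h2, h]
  have ℓu : ∀ {u}, u ∈ secondSphere G y ∧ u ∉ secondSphere G x → ℓ u = 4 := fun {u} h => by
    have h1 : u ≠ x := by rintro rfl; exact hxy.symm.notMem_secondSphere h.1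
    have h2 : ¬ G.Adj x u := fun h' => by
      obtain ⟨_, c, hc, hbc⟩ := AmplyRegular.mem_secondSphere.1 h.1
      exact (hxy h' hc).2 hbc
    simp [hℓ, h1, h2, h.1, h.2, hG.not_adj_of_mem h.1]
  have ℓy : ℓ y = 5 := by
    have := hxy.notMem_secondSphere
    have h' : y ∉ secondSphere G y := by simp [AmplyRegular.mem_secondSphere]
    simp [hℓ, hne.symm, hnadj, this, h']
  have ℓe : ∀ {g s t}, s ≠ t → P s t ∈ secondSphere G y → G.Adj g (P s t) → ¬ G.Adj x g →
      ¬ G.Adj y g → ℓ g = 6 := by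
    intro g s t hst hm hg gx gy
    obtain ⟨h1, h2⟩ := hstarS hst hm hg gx gy
    have h3 : g ≠ x := by rintro rfl; exact hG.not_adj_of_mem (F.mem_secondSphere hst) hg
    have h4 : g ≠ y := by rintro rfl; exact hyPadj hst hg
    simp [hℓ, gx, gy, h1, h2, h3, h4]
  have ℓe1 := ℓe (by decide) h03 e1_03 e1x e1y
  have ℓe2 := ℓe (by decide) h02 e2_02 e2x e2y
  have ℓf1 := ℓe (by decide) h04 f1_04 f1x f1y
  have ℓf2 := ℓe (by decide) h24 f2_24 f2x f2y
  have ℓb02 := ℓb b02y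
  have ℓb03 := ℓb b03y
  have ℓb12 := ℓb b12y
  have ℓb13 := ℓb b13y
  have ℓbc := ℓb bcy
  have ℓu1 := ℓu hu1U
  have ℓu2 := ℓu hu2U
  have hsep : ∀ {v w}, ℓ v ≠ ℓ w → v ≠ w := fun h h' => h (congrArg ℓ h')
  clear_value ℓ
  -- the entries `x` on and below the diagonals of `q` and `q'` are irrelevant
  refine nonempty_iso_boxProd hconn
    (fun v => by rw [← G.card_neighborFinset_eq_degree, hG.card_nbr])
    (r := x) (r' := a 4) (n := ![a 0, a 1, a 2, a 3]) (n' := ![P 0 4, P 1 4, P 2 4, P 3 4])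
    (q := ![![x, P 0 1, P 0 2, P 0 3], ![x, x, P 1 2, P 1 3], ![x, x, x, P 2 3], ![x, x, x, x]])
    (q' := ![![x, f₁, b02, b03], ![x, x, b12, b13], ![x, x, x, f₂], ![x, x, x, x]])
    (c₁ := bc) (c₂ := e₁) (c₃ := e₂) (c₁' := y) (c₂' := u₁) (c₃' := u₂)
    ⟨?_, ?_, ?_, ?_, ?_, ?_⟩ ⟨?_, ?_, ?_, ?_, ?_, ?_⟩ (F.adj 4) ?_ ?_ bcy.symm e1u1 e2u2 ?_
  · intro i; fin_cases i <;> exact F.adj _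
  · intro i j hij
    fin_cases i <;> fin_cases j <;> first
      | exact absurd hij (by decide)
      | exact (F.adj_left (by decide)).symm
  · intro i j hij
    fin_cases i <;> fin_cases j <;> first
      | exact absurd hij (by decide)
      | exact (F.adj_right (by decide)).symm
  · exact ⟨bc_02.symm, bc_03.symm, bc_12.symm, bc_13.symm⟩
  · exact ⟨e1_01.symm, e1_03.symm, e1_12.symm, e1_23.symm⟩
  · exact ⟨e2_01.symm, e2_02.symm, e2_13.symm, e2_23.symm⟩
  · intro i; fin_cases i <;> exact F.adj_right (by decide)
  · intro i j hij
    fin_cases i <;> fin_cases j <;> first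
      | exact absurd hij (by decide)
      | assumption
  · intro i j hij
    fin_cases i <;> fin_cases j <;> first
      | exact absurd hij (by decide)
      | assumption
  · exact ⟨b02y.symm, b03y.symm, b12y.symm, b13y.symm⟩
  · exact ⟨f1u1, u1_03.symm, u1_12.symm, f2u1⟩
  · exact ⟨f1u2, u2_02.symm, u2_13.symm, f2u2⟩
  · intro i; fin_cases i <;> exact F.adj_left (by decide)
  · intro i j hij
    fin_cases i <;> fin_cases j <;> first
      | exact absurd hij (by decide)
      | exact G.adj_symm (by assumption)
  · change [x, P 1 2, P 2 3, P 0 3, P 1 3, P 0 2, P 0 1, a 0, a 1, a 2, e₁, a 3, bc, e₂,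
      a 4, b12, f₂, b03, b13, b02, f₁, P 0 4, P 1 4, P 2 4, u₁, P 3 4, y, u₂].Nodup
    simp only [List.nodup_cons, List.mem_cons, List.not_mem_nil, not_or, or_false,
      not_false_eq_true, List.nodup_nil, and_true]
    and_intros <;> first
      | (refine hsep ?_
         simp only [ℓx, ℓa, ℓy, ℓe1, ℓe2, ℓf1, ℓf2, ℓb02, ℓb03, ℓb12, ℓb13, ℓbc, ℓu1, ℓu2, ne_eq,
           ℓP (show (0 : Fin 5) ≠ 1 by decide), ℓP (show (0 : Fin 5) ≠ 2 by decide),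
           ℓP (show (0 : Fin 5) ≠ 3 by decide), ℓP (show (0 : Fin 5) ≠ 4 by decide),
           ℓP (show (1 : Fin 5) ≠ 2 by decide), ℓP (show (1 : Fin 5) ≠ 3 by decide),
           ℓP (show (1 : Fin 5) ≠ 4 by decide), ℓP (show (2 : Fin 5) ≠ 3 by decide),
           ℓP (show (2 : Fin 5) ≠ 4 by decide), ℓP (show (3 : Fin 5) ≠ 4 by decide)]
         decide)
      | exact F.inj.ne (by decide)
      | exact F.label_ne hR (by decide) (by decide) (by decide)
      | assumption
      | exact Ne.symm (by assumption)

end IsFrame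

/-! ### The dichotomy -/

/-- In valency five, the labels `ij` for which `P i j` is not a midpoint form a matching. If it is
empty, the second spheres of `x` and `y` coincide; it cannot consist of one edge; and if
it has two edges, the graph is determined. -/
lemma IsHalfRegular.eq_or_nonempty_iso (hG : IsHalfRegular G 2) (hconn : G.Connected)
    (hdiam : ∀ u v, IsFar G u v → ∃ z, z ∈ secondSphere G u ∧ z ∈ secondSphere G v) {x y : V}
    (hxy : IsFar G x y) : secondSphere G x = secondSphere G y ∨
      Nonempty (G ≃g (SimpleGraph.completeGraph (Fin 2) □ lambdaGraph)) := by
  have hR := hG.isRectagraph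
  obtain ⟨a, P, F⟩ := hR.exists_frame x (n := 5) (by
    rw [← G.card_neighborFinset_eq_degree, hG.card_nbr])
  by_cases hsub : secondSphere G x ⊆ secondSphere G y
  · left
    exact eq_of_subset_of_card_le hsub (by rw [hG.card_secondSphere, hG.card_secondSphere])
  right
  have huniq : ∀ {s k l : Fin 5}, s ≠ k → s ≠ l → P s k ∉ secondSphere G y →
      P s l ∉ secondSphere G y → k = l := by
    intro s k l h1 h2 h3 h4
    obtain ⟨j, hsj, hj⟩ := F.exists_mid hG hxy hdiam s
    exact F.missing_unique hG hxy hsj hj h1 h2 h3 h4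
  obtain ⟨w, hwx, hwy⟩ := not_subset.1 hsub
  obtain ⟨i, j, hij, rfl⟩ := F.exists_eq_of_mem hR hwx
  have hji : P j i ∉ secondSphere G y := by rwa [F.symm]
  by_cases htwo : ∃ k l, k ≠ l ∧ P k l ∉ secondSphere G y ∧
      ¬ ((k = i ∧ l = j) ∨ (k = j ∧ l = i))
  swap
  · push Not at htwo
    refine (F.false_of_one_missing hG hxy hij hwy fun s t hst h => ?_).elim
    by_contra hn
    exact h (htwo s t hst hn)
  obtain ⟨k, l, hkl, hklm, hne⟩ := htwo
  have hlk : P l k ∉ secondSphere G y := by rwa [F.symm]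
  have hki : k ≠ i := by
    rintro rfl; exact hne (Or.inl ⟨rfl, huniq hkl hij hklm hwy⟩)
  have hkj : k ≠ j := by
    rintro rfl; exact hne (Or.inr ⟨rfl, huniq hkl hij.symm hklm hji⟩)
  have hli : l ≠ i := by
    rintro rfl; exact hne (Or.inr ⟨huniq hkl.symm hij hlk hwy, rfl⟩)
  have hlj : l ≠ j := by
    rintro rfl; exact hne (Or.inl ⟨huniq hkl.symm hij.symm hlk hji, rfl⟩)
  obtain ⟨m, hmi, hmj, hmk, hml⟩ := (by decide : ∀ i j k l : Fin 5, ∃ m : Fin 5,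
    m ≠ i ∧ m ≠ j ∧ m ≠ k ∧ m ≠ l) i j k l
  have hinj : Function.Injective ![i, j, k, l, m] := by
    have : [i, j, k, l, m] = List.ofFn ![i, j, k, l, m] := by simp [List.ofFn_succ]
    rw [← List.nodup_ofFn, ← this]
    simp [hij, hki.symm, hli.symm, hmi.symm, hkj.symm, hlj.symm, hmj.symm, hkl, hmk.symm, hml.symm]
  obtain ⟨σ, hσ⟩ : ∃ σ : Equiv.Perm (Fin 5), ∀ c, σ c = ![i, j, k, l, m] c :=
    ⟨Equiv.ofBijective _ (Finite.injective_iff_bijective.1 hinj), fun _ => rfl⟩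
  obtain rfl : σ 0 = i := hσ 0
  obtain rfl : σ 1 = j := hσ 1
  obtain rfl : σ 2 = k := hσ 2
  obtain rfl : σ 3 = l := hσ 3
  -- the only missing labels at `0`, `1`, `2`, `3` are `01` and `23`
  have h4 : ∀ s t, s ≠ t → P (σ s) (σ t) ∉ secondSphere G y →
      (s = 0 → t = 1) ∧ (s = 1 → t = 0) ∧ (s = 2 → t = 3) ∧ (s = 3 → t = 2) := by
    intro s t hst hn
    have hst' : σ s ≠ σ t := σ.injective.ne hst
    refine ⟨?_, ?_, ?_, ?_⟩ <;> rintro rfl <;> apply σ.injective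
    · exact huniq hst' hij hn hwy
    · exact huniq hst' hij.symm hn hji
    · exact huniq hst' hkl hn hklm
    · exact huniq hst' hkl.symm hn hlk
  have hin : ∀ s t, s ≠ t → ¬ ((s = 0 → t = 1) ∧ (s = 1 → t = 0) ∧ (s = 2 → t = 3) ∧
      (s = 3 → t = 2)) → P (σ s) (σ t) ∈ secondSphere G y :=
    fun s t hst h => by_contra fun hn => h (h4 s t hst hn)
  exact (F.comp σ).nonempty_iso_of_two_missing hG hxy hconn ⟨hwy, hklm,
    hin 0 2 (by decide) (by decide), hin 0 3 (by decide) (by decide),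
    hin 1 2 (by decide) (by decide), hin 1 3 (by decide) (by decide),
    hin 0 4 (by decide) (by decide), hin 1 4 (by decide) (by decide),
    hin 2 4 (by decide) (by decide), hin 3 4 (by decide) (by decide)⟩

/-- Let `G` be triangle-free of valency `2 * m + 1` and diameter four, with `m` common neighbours for
vertices at distance two. Then `G` is bipartite, with `8 * m + 8` vertices unless it is the
product of an edge and `Λ`. -/
lemma IsHalfRegular.isBipartite_and {m : ℕ} (hG : IsHalfRegular G m) (hconn : G.Connected)
    (hdiam : ∀ u v, G.dist u v ≤ 4) {x y : V} (hd : G.dist x y = 4) :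
    G.IsBipartite ∧ (Fintype.card V = 8 * m + 8 ∨
      Nonempty (G ≃g (SimpleGraph.completeGraph (Fin 2) □ lambdaGraph))) := by
  have hxy : IsFar G x y := (hG.isFar_iff hconn).2 hd.ge
  suffices h : secondSphere G x = secondSphere G y ∨
      Nonempty (G ≃g (SimpleGraph.completeGraph (Fin 2) □ lambdaGraph)) by
    rcases h with h | h
    · have := hG.isBipartite_of_secondSphere_eq hconn hxy h
      exact ⟨this.1, Or.inl this.2⟩
    · refine ⟨?_, Or.inr h⟩
      obtain ⟨φ⟩ := h
      obtain ⟨c⟩ := isBipartiteZeroTwoGraph144_lambdaGraph.bipartite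
      -- the colours of the two factors are added
      refine SimpleGraph.Colorable.of_hom φ.toHom
        ⟨SimpleGraph.Coloring.mk (fun p => p.1 + c p.2) ?_⟩
      rintro ⟨i, v⟩ ⟨j, w⟩ h
      rw [SimpleGraph.boxProd_adj] at h
      rcases h with ⟨h1, h2⟩ | ⟨h1, h2⟩
      · obtain rfl : v = w := h2
        have h1 : i ≠ j := h1
        simpa using h1
      · obtain rfl : i = j := h2
        simpa using c.valid h1
  rcases hG.two_le.lt_or_eq with hm | rfl
  · left
    obtain ⟨z, hzx, hzy⟩ := hG.exists_mid hconn hd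
    exact (hG.secondSphere_subset hm hxy hzx hzy).antisymm
      (hG.secondSphere_subset hm hxy.symm hzy hzx)
  · refine hG.eq_or_nonempty_iso hconn (fun u v huv => ?_) hxy
    exact hG.exists_mid hconn (le_antisymm (hdiam u v) ((hG.isFar_iff hconn).1 huv))

end AmplyRegular

theorem theorem4p7 {V : Type*} [Fintype V] [DecidableEq V] (G : SimpleGraph V)
    [DecidableRel G.Adj] (v k : ℕ) (hk : 5 ≤ k) (hodd : Odd k)
    (hconn : G.Connected) (hdiam : G.diam = 4)
    (hG : AmplyRegular.IsAmplyRegularWith G v k 0 ((k - 1) / 2)) :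
    -- `lambdaGraph` is the unique bipartite `(0,2)`-graph with 14 vertices and valency 4
    (∀ {W : Type*} [Fintype W] [DecidableEq W] (L : SimpleGraph W) [DecidableRel L.Adj],
      AmplyRegular.IsBipartiteZeroTwoGraph144 L ↔ Nonempty (L ≃g AmplyRegular.lambdaGraph)) ∧
    G.IsBipartite ∧
    Xor (Nonempty (G ≃g (SimpleGraph.completeGraph (Fin 2) □ AmplyRegular.lambdaGraph)))
      (AmplyRegular.IsQRegularWithDiagram G (AmplyRegular.diagramSizes k) (AmplyRegular.diagramMatrix k)) ∧
    (AmplyRegular.IsQRegularWithDiagram G (AmplyRegular.diagramSizes k) (AmplyRegular.diagramMatrix k) →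
      (∀ x : V, ∃! y : V, G.dist x y = 4) ∧ v = 4 * k + 4) := by
  obtain ⟨m, rfl⟩ := hodd
  rw [show (2 * m + 1 - 1) / 2 = m by omega] at hG
  have hH : AmplyRegular.IsHalfRegular G m := hG.isHalfRegular (by omega) hconn
  have : Nonempty V := hconn.nonempty
  have hle : ∀ u w, G.dist u w ≤ 4 := fun u w => by
    rw [← hdiam]
    exact SimpleGraph.dist_le_diam (SimpleGraph.ediam_ne_top_of_diam_ne_zero (by omega))
  obtain ⟨x, y, hxy⟩ := G.exists_dist_eq_diam
  obtain ⟨hbip, hcase⟩ := hH.isBipartite_and hconn hle (hxy.trans hdiam)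
  have c : G.Coloring Bool := hbip.toColoring (by simp)
  refine ⟨fun L => AmplyRegular.isBipartiteZeroTwoGraph144_iff, hbip, ?_, fun hQ => ?_⟩
  · -- the product has `28 ≠ 4 * k + 4` vertices, as `k` is odd
    have hexcl : Nonempty (G ≃g (SimpleGraph.completeGraph (Fin 2) □ AmplyRegular.lambdaGraph)) →
        ¬ Fintype.card V = 8 * m + 8 := by
      rintro ⟨φ⟩ h
      have h1 := Fintype.card_congr φ.toEquiv
      simp only [Fintype.card_prod, Fintype.card_fin, Fintype.card_sum] at h1
      omega
    rcases hcase with h | h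
    · exact Or.inr ⟨hH.isQRegular c h, fun h' => hexcl h' h⟩
    · refine Or.inl ⟨h, fun h' => hexcl h ?_⟩
      rw [h'.card_eq]; ring
  · have hcard := hQ.card_eq
    refine ⟨hH.existsUnique_dist_eq_four hconn hle c (by rw [hcard]; ring), ?_⟩
    rw [← hG.card, hcard]
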